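/- Let $n\ge 1$, let $E\subset\mathbb R^n$ be Lebesgue measurable, let $p\in\partial E$ and $R>0$. For $s\in(0,1)$ and $x\in\partial E$ let $$\mathcal I_s[E](x)=\lim_{\rho\to0^+}\int_{\mathbb R^n\setminus B_\rho(x)}\frac{\chi_{\mathbb R^n\setminus E}(y)-\chi_E(y)}{|y-x|^{n+s}}\,dy$$ be the $s$-fractional mean curvature, and let $\omega_k=\mathcal H^{k-1}(\mathbb S^{k-1})$ be the area of the unit sphere of $\mathbb R^k$, with $\omega_0=0$. We say that $\partial E$ is $C^{1,\alpha}$ (respectively $C^2$) in $B_R(p)$ if for every $x\in\partial E\cap B_R(p)$ there are orthonormal coordinates $(z',z_n)$ centred at $x$, numbers $r,h>0$ and a function $u$ on $B'_r=\{z'\in\mathbb R^{n-1}:|z'|<r\}$ with $u(0)=0$, of class $C^1$ with $\alpha$-Hölder continuous gradient on $B'_r$ (respectively of class $C^2$), such that in the cylinder $\{|z'|<r,\ |z_n|<h\}$ the points with $z_n>u(z')$ belong to $E$ and those with $z_n<u(z')$ do not. (1) Let $\alpha\in(0,1]$ and let $\partial E$ be $C^{1,\alpha}$ in $B_R(p)$.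 Then for all $s\in(0,\alpha)$ and $x\in\partial E\cap B_R(p)$ the limit $\mathcal I_s[E](x)$ exists and is finite, and the map $$(0,\alpha)\times(\partial E\cap B_R(p))\to\mathbb R,\qquad (s,x)\mapsto\mathcal I_s[E](x)$$ is continuous. (2) Let $\partial E$ be $C^2$ in $B_R(p)$. For $x\in\partial E\cap B_R(p)$ put $\tilde{\mathcal I}_s[E](x)=s(1-s)\,\mathcal I_s[E](x)$ for $s\in(0,1)$ and $\tilde{\mathcal I}_1[E](x)=\omega_{n-1}H[E](x)$, where $H[E](x)$ is the classical mean curvature of $\partial E$ at $x$, normalized as the arithmetic mean of the $n-1$ principal curvatures and positive for balls; in a local representation of $E$ as a supergraph of $u$ as above, $H[E]=\frac1{n-1}\operatorname{div}\big(\nabla u/\sqrt{1+|\nabla u|^2}\big)$. (For $n=1$, $\tilde{\mathcal I}_1[E](x)=0$.) Then $\mathcal I_s[E](x)$ exists and is finite for all $s\in(0,1)$ and $x\in\partial E\cap B_R(p)$, and the map $$(0,1]\times(\partial E\cap B_R(p))\to\mathbb R,\qquad (s,x)\mapsto\tilde{\mathcal I}_s[E](x)$$ is continuous. (3) Let $\alpha\in(0,1]$,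 let $\partial E$ be $C^{1,\alpha}$ in $B_R(p)$, and suppose that the limit $$\alpha(E)=\lim_{s\to0^+}s\int_{\mathbb R^n\setminus B_1}\frac{\chi_E(y)}{|y|^{n+s}}\,dy$$ exists. For $x\in\partial E\cap B_R(p)$ put $\tilde{\mathcal I}_s[E](x)=s(1-s)\,\mathcal I_s[E](x)$ for $s\in(0,1)$ and $\tilde{\mathcal I}_0[E](x)=\omega_n-2\alpha(E)$. Then the map $$[0,\alpha)\times(\partial E\cap B_R(p))\to\mathbb R,\qquad (s,x)\mapsto\tilde{\mathcal I}_s[E](x)$$ is continuous. -/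

import Mathlib

open Set Filter Topology MeasureTheory

noncomputable section

/-- Euclidean space `ℝⁿ`. -/
abbrev RSpace (n : ℕ) : Type := EuclideanSpace ℝ (Fin n)

/-- `ω_n`: the surface area of the unit sphere of `ℝⁿ`, i.e. the total mass of the surface measure
on the sphere (so that the unit ball has volume `ω_n / n`); `ω_0 = 0`. -/
def sphereArea (n : ℕ) : ℝ :=
  ((volume : Measure (RSpace n)).toSphere).real univ

/-- The kernel `(χ_{Eᶜ}(y) - χ_E(y)) / |y - q|^{n+s}`. -/
def fracKernel {n : ℕ} (s : ℝ) (E : Set (RSpace n)) (q y : RSpace n) : ℝ :=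
  (Eᶜ.indicator (fun _ => (1 : ℝ)) y - E.indicator (fun _ => (1 : ℝ)) y) /
    ‖y - q‖ ^ ((n : ℝ) + s)

/-- The truncated curvature `I_s^ρ[E](q)`: the integral of the kernel outside `B_ρ(q)`. -/
def truncFracCurvature {n : ℕ} (s : ℝ) (E : Set (RSpace n)) (q : RSpace n) (ρ : ℝ) : ℝ :=
  ∫ y in (Metric.ball q ρ)ᶜ, fracKernel s E q y

/-- The principal value defining `I_s[E](q)` exists as a finite limit equal to `L`: the truncated
integrals converge absolutely, and they tend to `L` as `ρ → 0⁺`. -/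
def HasFracCurvature {n : ℕ} (s : ℝ) (E : Set (RSpace n)) (q : RSpace n) (L : ℝ) : Prop :=
  (∀ ρ : ℝ, 0 < ρ → IntegrableOn (fracKernel s E q) (Metric.ball q ρ)ᶜ volume) ∧
    Tendsto (truncFracCurvature s E q) (𝓝[>] 0) (𝓝 L)

/-- The `s`-fractional mean curvature `I_s[E](q) = lim_{ρ → 0⁺} I_s^ρ[E](q)`. -/
def fracCurvature {n : ℕ} (s : ℝ) (E : Set (RSpace n)) (q : RSpace n) : ℝ :=
  limUnder (𝓝[>] (0 : ℝ)) (truncFracCurvature s E q)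

/-- `α(E)` exists and equals `a`, where
`α(E) = lim_{s → 0⁺} s ∫_{ℝⁿ \ B_1} χ_E(y) / |y|^{n+s} dy`. -/
def HasContributionAtInfinity {n : ℕ} (E : Set (RSpace n)) (a : ℝ) : Prop :=
  Tendsto
    (fun s : ℝ => s * ∫ y in (Metric.ball (0 : RSpace n) 1)ᶜ,
      E.indicator (fun _ => (1 : ℝ)) y / ‖y‖ ^ ((n : ℝ) + s))
    (𝓝[>] 0) (𝓝 a)

/-- Orthonormal coordinates `(z', z_n)` on `ℝⁿ`, the last one being singled out (there are none
for `n = 0`). -/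
abbrev OrthoCoords (n : ℕ) : Type := RSpace n ≃ₗᵢ[ℝ] WithLp 2 (RSpace (n - 1) × ℝ)

/-- In the orthonormal coordinates `(z', z_n) = Φ (y - x)` centred at `x`, and inside the cylinder
`|z'| < r`, `|z_n| < h`, the set `E` is the region above the graph of `u`, which passes through `x`.
Whether points of the graph itself belong to `E` is left open. -/
def IsLocalSupergraph {n : ℕ} (E : Set (RSpace n)) (x : RSpace n) (Φ : OrthoCoords n) (r h : ℝ)
    (u : RSpace (n - 1) → ℝ) : Prop :=
  0 < r ∧ 0 < h ∧ u 0 = 0 ∧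
    ∀ y : RSpace n, ‖(Φ (y - x)).fst‖ < r → |(Φ (y - x)).snd| < h →
      (u (Φ (y - x)).fst < (Φ (y - x)).snd → y ∈ E) ∧
      ((Φ (y - x)).snd < u (Φ (y - x)).fst → y ∉ E)

/-- `∂E` is of class `C^{1,a}` in the set `U`: around each point of `∂E ∩ U`, up to a rigid motion,
`E` is the supergraph of a `C¹` function whose gradient is `a`-Hölder continuous. -/
def IsC1HolderBoundaryIn {n : ℕ} (E : Set (RSpace n)) (a : ℝ) (U : Set (RSpace n)) : Prop :=
  ∀ x ∈ frontier E ∩ U, ∃ (Φ : OrthoCoords n) (r h : ℝ) (u : RSpace (n - 1) → ℝ),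
    IsLocalSupergraph E x Φ r h u ∧ ContDiffOn ℝ 1 u (Metric.ball 0 r) ∧
      ∃ C : ℝ, ∀ z ∈ Metric.ball (0 : RSpace (n - 1)) r, ∀ w ∈ Metric.ball (0 : RSpace (n - 1)) r,
        ‖gradient u z - gradient u w‖ ≤ C * ‖z - w‖ ^ a

/-- `∂E` is of class `C²` in the set `U`. -/
def IsC2BoundaryIn {n : ℕ} (E : Set (RSpace n)) (U : Set (RSpace n)) : Prop :=
  ∀ x ∈ frontier E ∩ U, ∃ (Φ : OrthoCoords n) (r h : ℝ) (u : RSpace (n - 1) → ℝ),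
    IsLocalSupergraph E x Φ r h u ∧ ContDiffOn ℝ 2 u (Metric.ball 0 r)

/-- The mean curvature at `z` of the graph of `u : ℝᵐ → ℝ`, seen as the boundary of its
supergraph: `(1/m) div (∇u / √(1 + |∇u|²)) (z)`, the arithmetic mean of the `m` principal
curvatures. -/
def graphMeanCurvature {m : ℕ} (u : RSpace m → ℝ) (z : RSpace m) : ℝ :=
  (m : ℝ)⁻¹ * LinearMap.trace ℝ (RSpace m)
    (fderiv ℝ (fun w : RSpace m => (Real.sqrt (1 + ‖gradient u w‖ ^ 2))⁻¹ • gradient u w) z :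
      RSpace m →ₗ[ℝ] RSpace m)

/-- `κ` is the mean curvature of `∂E` at `x`, computed in some local `C²` graph representation. -/
def IsMeanCurvatureAt {n : ℕ} (E : Set (RSpace n)) (x : RSpace n) (κ : ℝ) : Prop :=
  ∃ (Φ : OrthoCoords n) (r h : ℝ) (u : RSpace (n - 1) → ℝ),
    IsLocalSupergraph E x Φ r h u ∧ ContDiffOn ℝ 2 u (Metric.ball 0 r) ∧
      κ = graphMeanCurvature u 0

open Classical in
/-- The classical mean curvature `H[E](x)` (mean of the principal curvatures, positive for balls) at
a `C²` boundary point, where it does not depend on the graph representation; `0` elsewhere. -/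
def meanCurvature {n : ℕ} (E : Set (RSpace n)) (x : RSpace n) : ℝ :=
  if hx : ∃ κ : ℝ, IsMeanCurvatureAt E x κ then hx.choose else 0

/-- A `C²` boundary has a mean curvature at each of its points. -/
theorem IsC2BoundaryIn.isMeanCurvatureAt {n : ℕ} {E U : Set (RSpace n)} (hE : IsC2BoundaryIn E U)
    {x : RSpace n} (hx : x ∈ frontier E ∩ U) : IsMeanCurvatureAt E x (meanCurvature E x) := by
  have hex : ∃ κ : ℝ, IsMeanCurvatureAt E x κ := by
    obtain ⟨Φ, r, h, u, h1, h2⟩ := hE x hx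
    exact ⟨_, Φ, r, h, u, h1, h2, rfl⟩
  unfold meanCurvature
  rw [dif_pos hex]
  exact hex.choose_spec

/-- `Ĩ_s[E](x) = s (1 - s) I_s[E](x)` for `s ≠ 1`, and `Ĩ_1[E](x) = ω_{n-1} H[E](x)`. -/
def rescaledCurvatureToOne {n : ℕ} (E : Set (RSpace n)) (s : ℝ) (x : RSpace n) : ℝ :=
  if s = 1 then sphereArea (n - 1) * meanCurvature E x else s * (1 - s) * fracCurvature s E x

/-- `Ĩ_s[E](x) = s (1 - s) I_s[E](x)` for `s ≠ 0`, and `Ĩ_0[E](x) = ω_n - 2 a`, where `a` stands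
for `α(E)`. -/
def rescaledCurvatureToZero {n : ℕ} (E : Set (RSpace n)) (a : ℝ) (s : ℝ) (x : RSpace n) : ℝ :=
  if s = 0 then sphereArea n - 2 * a else s * (1 - s) * fracCurvature s E x

end

/-!
# Continuity of the fractional mean curvature in the point and in the order

Write `σ = χ_{Eᶜ} - χ_E`. The domain `{|w| ≥ ρ}` is invariant under `w ↦ -w`, so the truncated
curvature at `x` is the integral of the even part `½ (σ(x + w) + σ(x - w)) |w|^{-(n+s)}`
(`symKernel`). If `∂E` is `C^{1,α}` at `x` with unit normal `ν`, then `E` is pinched between the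
paraboloids `⟪w, ν⟫ = ± C |w|^{1+α}` (`exists_isPinched_of_holder`), and `σ(x + w)`, `σ(x - w)`
cancel outside the slab `|⟪w, ν⟫| ≤ C |w|^{1+α}`. In orthonormal coordinates `w = (y, t)` adapted to
`ν` the slab has thickness of order `|y|^{1+α}`, so for `s < α` the even part is integrable and its
integral over `B_η` is `O(η^{α-s} / (α - s))`, with constants uniform in `x`
(`integrableOn_symKernel_of_isPinched`). The principal value is thus an absolutely convergent
integral, and it is a locally uniform limit of the truncated curvatures. These are continuous in
`(s, x)` for every measurable `E`, because away from the singularity the translation may be put on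
the kernel (`continuousAt_truncFracCurvature`).

As `s → 0`, the part of the integral near `x` stays bounded and is killed by the factor `s`; the
remaining part is `ω_n δ^{-s} / s - 2 ∫ χ_E |y - x|^{-(n+s)}`, and moving the centre and the radius
of the cut-off changes the last integral by an amount bounded uniformly in `s`
(`exists_abs_cutKernel_sub_le`).

As `s → 1`, the part of the integral far from `x` is killed by the factor `1 - s`. A `C²` boundary
is pinched, up to `ε |w|²`, along a paraboloid `⟪w, ν_x⟫ = ⟪A w, w⟫`, where `A` may be kept fixed
while `x` varies near `x₀` (`exists_isPinched_of_contDiffOn_two`). Up to relative errors of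
order `ε`, the even part of `σ` is then the sign of `⟪A y, y⟫` on `|t| < |⟪A y, y⟫|` and zero elsewhere, whose
integral `∫_{|y| < δ} 2 ⟪A y, y⟫ |y|^{-(n+s)} dy` equals
`2 (tr A - ⟪A ν_x, ν_x⟫) / (n - 1) · ω_{n-1} δ^{1-s} / (1 - s)` by rotational symmetry
(`abs_integral_symKernel_sub_le`). For the graph of `u` the coefficient at `x₀` is its mean
curvature (`graphMeanCurvature_eq_graphForm`). This limit is locally uniform, holds for every graph
representation, and so gives both the continuity at `s = 1` of the rescaled curvature and that of
the mean curvature itself.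
-/

/-! ### Radial integrals -/

theorem sphereArea_eq (n : ℕ) :
    sphereArea n = n * (volume : Measure (RSpace n)).real (Metric.ball 0 1) := by
  rw [sphereArea, Measure.toSphere_real_apply_univ]
  simp

theorem sphereArea_zero : sphereArea 0 = 0 := by
  rw [sphereArea_eq]; simp

theorem sphereArea_nonneg (n : ℕ) : 0 ≤ sphereArea n := measureReal_nonneg

theorem integral_radial (m : ℕ) [NeZero m] (f : ℝ → ℝ) :
    ∫ y : RSpace m, f ‖y‖ = sphereArea m * ∫ r in Ioi (0 : ℝ), r ^ (m - 1) * f r := by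
  rw [integral_fun_norm_addHaar volume f, sphereArea_eq]
  simp [mul_assoc]

theorem integrableOn_norm_rpow_ball (m : ℕ) {β δ : ℝ} (hβ : 0 < β) (hδ : 0 < δ) :
    IntegrableOn (fun y : RSpace m => ‖y‖ ^ (β - m)) (Metric.ball 0 δ) := by
  rcases Nat.eq_zero_or_pos m with rfl | hm
  -- in dimension zero the polar coordinate formula is not available
  · have : (fun y : RSpace 0 => ‖y‖ ^ (β - (0 : ℕ))) = fun _ => (0 : ℝ) ^ (β - (0 : ℕ)) := by
      ext y; rw [Subsingleton.elim y 0, norm_zero]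
    rw [this]
    exact integrableOn_const (measure_ball_lt_top.ne)
  · have : NeZero m := ⟨hm.ne'⟩
    have key := integrableOn_fun_norm_addHaar (volume : Measure (RSpace m))
      (f := fun r : ℝ => r ^ (β - m)) (r := δ)
    rw [key]
    have h2 : IntegrableOn (fun r : ℝ => r ^ (β - 1)) (Ioo 0 δ) :=
      (intervalIntegral.integrableOn_Ioo_rpow_iff hδ).2 (by linarith)
    refine h2.congr_fun (fun r hr => ?_) measurableSet_Ioo
    have hr0 : 0 < r := hr.1
    simp only [finrank_euclideanSpace, Fintype.card_fin, smul_eq_mul]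
    rw [← Real.rpow_natCast, ← Real.rpow_add hr0, Nat.cast_sub hm]
    congr 1; push_cast; ring

theorem integral_norm_rpow_ball (m : ℕ) {β δ : ℝ} (hβ : 0 < β) (hδ : 0 < δ) :
    ∫ y in Metric.ball (0 : RSpace m) δ, ‖y‖ ^ (β - m) = sphereArea m * (δ ^ β / β) := by
  rcases Nat.eq_zero_or_pos m with rfl | hm
  · have : (fun y : RSpace 0 => ‖y‖ ^ (β - (0 : ℕ))) = fun _ => (0 : ℝ) := by
      ext y; rw [Subsingleton.elim y 0, norm_zero, Nat.cast_zero, sub_zero, Real.zero_rpow hβ.ne']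
    rw [this]; simp [sphereArea_zero]
  · have : NeZero m := ⟨hm.ne'⟩
    have h1 : ∀ y : RSpace m, (Metric.ball (0 : RSpace m) δ).indicator
        (fun y => ‖y‖ ^ (β - m)) y = (Iio δ).indicator (fun r : ℝ => r ^ (β - m)) ‖y‖ := by
      intro y
      simp [indicator]
    rw [← integral_indicator measurableSet_ball, integral_congr_ae (Eventually.of_forall h1),
      integral_radial]
    congr 1
    have h2 : ∀ r ∈ Ioi (0 : ℝ), r ^ (m - 1) * (Iio δ).indicator (fun r : ℝ => r ^ (β - m)) r =
        (Iio δ).indicator (fun r : ℝ => r ^ (β - 1)) r := by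
      intro r hr
      have hr0 : (0 : ℝ) < r := hr
      by_cases hrδ : r < δ
      · simp only [indicator, mem_Iio, hrδ, if_true]
        rw [← Real.rpow_natCast, ← Real.rpow_add hr0, Nat.cast_sub hm]
        congr 1; push_cast; ring
      · simp [indicator, hrδ]
    rw [setIntegral_congr_fun measurableSet_Ioi h2, setIntegral_indicator measurableSet_Iio,
      Ioi_inter_Iio, ← integral_Ioc_eq_integral_Ioo, ← intervalIntegral.integral_of_le hδ.le,
      integral_rpow (Or.inl (by linarith))]
    simp [Real.zero_rpow hβ.ne']

/-- In polar coordinates the kernel `|y|^{-(n+s)}` becomes `r^{-s-1}`, integrable at infinity. -/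
theorem integrableOn_norm_rpow_compl_ball (n : ℕ) {s δ : ℝ} (hs : 0 < s) (hδ : 0 < δ) :
    IntegrableOn (fun y : RSpace n => ‖y‖ ^ (-((n : ℝ) + s))) (Metric.ball 0 δ)ᶜ ∧
    ∫ y in (Metric.ball (0 : RSpace n) δ)ᶜ, ‖y‖ ^ (-((n : ℝ) + s)) =
      sphereArea n * (δ ^ (-s) / s) := by
  rcases Nat.eq_zero_or_pos n with rfl | hn
  · have : (Metric.ball (0 : RSpace 0) δ)ᶜ = ∅ := by
      ext y; rw [Subsingleton.elim y 0]; simp [hδ]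
    rw [this]
    simp [sphereArea_zero]
  · have : NeZero n := ⟨hn.ne'⟩
    have h1 : (Metric.ball (0 : RSpace n) δ)ᶜ.indicator (fun y => ‖y‖ ^ (-((n : ℝ) + s))) =
        fun y => (Ici δ).indicator (fun r : ℝ => r ^ (-((n : ℝ) + s))) ‖y‖ := by
      ext y
      simp [indicator]
    have h2 : ∀ r ∈ Ioi (0 : ℝ),
        r ^ (n - 1) * (Ici δ).indicator (fun r : ℝ => r ^ (-((n : ℝ) + s))) r =
        (Ici δ).indicator (fun r : ℝ => r ^ (-s - 1)) r := by
      intro r hr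
      have hr0 : (0 : ℝ) < r := hr
      by_cases hrδ : δ ≤ r
      · simp only [indicator, mem_Ici, hrδ, if_true]
        rw [← Real.rpow_natCast, ← Real.rpow_add hr0, Nat.cast_sub hn]
        congr 1; push_cast; ring
      · simp [indicator, hrδ]
    have h3 : Ioi (0 : ℝ) ∩ Ici δ = Ici δ := inter_eq_right.2 fun r hr => lt_of_lt_of_le hδ hr
    constructor
    · rw [← integrable_indicator_iff measurableSet_ball.compl, h1, integrable_fun_norm_addHaar]
      simp only [finrank_euclideanSpace, Fintype.card_fin, smul_eq_mul]
      rw [integrableOn_congr_fun h2 measurableSet_Ioi, IntegrableOn,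
        integrable_indicator_iff measurableSet_Ici, IntegrableOn, Measure.restrict_restrict
        measurableSet_Ici, inter_comm, h3, ← IntegrableOn, integrableOn_Ici_iff_integrableOn_Ioi]
      exact integrableOn_Ioi_rpow_of_lt (by linarith) hδ
    · rw [← integral_indicator measurableSet_ball.compl, h1, integral_radial,
        setIntegral_congr_fun measurableSet_Ioi h2, setIntegral_indicator measurableSet_Ici, h3,
        integral_Ici_eq_integral_Ioi, integral_Ioi_rpow_of_lt (by linarith) hδ]
      congr 1
      rw [sub_add_cancel, neg_div_neg_eq]

/-! ### The symmetrized kernel -/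

/-- The sign `χ_{Eᶜ} - χ_E`, equal to `-1` on `E` and to `1` off `E`. -/
noncomputable def sideSign {n : ℕ} (E : Set (RSpace n)) (y : RSpace n) : ℝ :=
  Eᶜ.indicator (fun _ => (1 : ℝ)) y - E.indicator (fun _ => (1 : ℝ)) y

section

variable {n : ℕ} {E : Set (RSpace n)}

theorem sideSign_of_mem {y : RSpace n} (h : y ∈ E) : sideSign E y = -1 := by
  simp [sideSign, h]

theorem sideSign_of_notMem {y : RSpace n} (h : y ∉ E) : sideSign E y = 1 := by
  simp [sideSign, h]

theorem abs_sideSign_le (E : Set (RSpace n)) (y : RSpace n) : |sideSign E y| ≤ 1 := by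
  by_cases h : y ∈ E
  · simp [sideSign_of_mem h]
  · simp [sideSign_of_notMem h]

theorem aestronglyMeasurable_sideSign (hE : NullMeasurableSet E volume) :
    AEStronglyMeasurable (sideSign E) volume :=
  (aestronglyMeasurable_const.indicator₀ hE.compl).sub (aestronglyMeasurable_const.indicator₀ hE)

theorem fracKernel_eq (s : ℝ) (E : Set (RSpace n)) (q y : RSpace n) :
    fracKernel s E q y = sideSign E y * ‖y - q‖ ^ (-((n : ℝ) + s)) := by
  rw [fracKernel, Real.rpow_neg (norm_nonneg _), div_eq_mul_inv, sideSign]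

theorem measurable_norm_rpow (n : ℕ) (p : ℝ) : Measurable (fun w : RSpace n => ‖w‖ ^ p) :=
  measurable_norm.pow_const p

theorem aestronglyMeasurable_sideSign_add (hE : NullMeasurableSet E volume) (x : RSpace n) :
    AEStronglyMeasurable (fun w => sideSign E (x + w)) volume :=
  (aestronglyMeasurable_sideSign hE).comp_measurePreserving (measurePreserving_add_left volume x)

theorem aestronglyMeasurable_sideSign_sub (hE : NullMeasurableSet E volume) (x : RSpace n) :
    AEStronglyMeasurable (fun w => sideSign E (x - w)) volume :=
  (aestronglyMeasurable_sideSign hE).comp_measurePreserving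
    (Measure.measurePreserving_sub_left volume x)

/-- The kernel of the fractional curvature at `x`, in the variable `w = y - x` and symmetrized
under `w ↦ -w`. -/
noncomputable def symKernel (s : ℝ) (E : Set (RSpace n)) (x w : RSpace n) : ℝ :=
  (sideSign E (x + w) + sideSign E (x - w)) / 2 * ‖w‖ ^ (-((n : ℝ) + s))

theorem aestronglyMeasurable_symKernel (hE : NullMeasurableSet E volume) (s : ℝ) (x : RSpace n) :
    AEStronglyMeasurable (symKernel s E x) volume :=
  ((((aestronglyMeasurable_sideSign_add hE x).add
    (aestronglyMeasurable_sideSign_sub hE x))).aemeasurable.div_const 2).aestronglyMeasurable.mul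
    (measurable_norm_rpow n _).aestronglyMeasurable

theorem abs_symKernel_le (s : ℝ) (E : Set (RSpace n)) (x w : RSpace n) :
    |symKernel s E x w| ≤ ‖w‖ ^ (-((n : ℝ) + s)) := by
  rw [symKernel, abs_mul, abs_of_nonneg (Real.rpow_nonneg (norm_nonneg w) _)]
  refine mul_le_of_le_one_left (Real.rpow_nonneg (norm_nonneg w) _) ?_
  have h1 := abs_le.1 (abs_sideSign_le E (x + w))
  have h2 := abs_le.1 (abs_sideSign_le E (x - w))
  rw [abs_le]; constructor <;> linarith

theorem integrableOn_translate_kernel (hE : NullMeasurableSet E volume) {s ρ : ℝ} (hs : 0 < s)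
    (hρ : 0 < ρ) (x : RSpace n) :
    IntegrableOn (fun w => sideSign E (x + w) * ‖w‖ ^ (-((n : ℝ) + s))) (Metric.ball 0 ρ)ᶜ := by
  refine Integrable.mono' (integrableOn_norm_rpow_compl_ball n hs hρ).1
    (((aestronglyMeasurable_sideSign_add hE x).mul
      (measurable_norm_rpow n _).aestronglyMeasurable).restrict) (Eventually.of_forall fun w => ?_)
  rw [Real.norm_eq_abs, abs_mul, abs_of_nonneg (Real.rpow_nonneg (norm_nonneg w) _)]
  exact mul_le_of_le_one_left (Real.rpow_nonneg (norm_nonneg w) _) (abs_sideSign_le _ _)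

theorem indicator_fracKernel_add (s : ℝ) (E : Set (RSpace n)) (x : RSpace n) (ρ : ℝ)
    (w : RSpace n) :
    (Metric.ball x ρ)ᶜ.indicator (fracKernel s E x) (x + w) =
      (Metric.ball 0 ρ)ᶜ.indicator
        (fun w => sideSign E (x + w) * ‖w‖ ^ (-((n : ℝ) + s))) w := by
  simp [indicator, fracKernel_eq]

theorem integrableOn_fracKernel (hE : NullMeasurableSet E volume) {s ρ : ℝ} (hs : 0 < s)
    (hρ : 0 < ρ) (x : RSpace n) : IntegrableOn (fracKernel s E x) (Metric.ball x ρ)ᶜ := by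
  have h := (integrable_indicator_iff measurableSet_ball.compl).2
    (integrableOn_translate_kernel hE hs hρ x)
  rw [← integrable_indicator_iff measurableSet_ball.compl,
    ← (measurePreserving_add_left volume x).integrable_comp_emb
      (MeasurableEquiv.addLeft x).measurableEmbedding]
  exact h.congr (Eventually.of_forall fun w => (indicator_fracKernel_add s E x ρ w).symm)

theorem truncFracCurvature_eq_translate (s : ℝ) (E : Set (RSpace n)) (x : RSpace n) (ρ : ℝ) :
    truncFracCurvature s E x ρ =
      ∫ w in (Metric.ball 0 ρ)ᶜ, sideSign E (x + w) * ‖w‖ ^ (-((n : ℝ) + s)) := by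
  rw [truncFracCurvature, ← integral_indicator measurableSet_ball.compl,
    ← integral_indicator measurableSet_ball.compl, ← integral_add_left_eq_self _ x]
  exact integral_congr_ae (Eventually.of_forall fun w => indicator_fracKernel_add s E x ρ w)

/-- Since the domain of integration is invariant under `w ↦ -w`, the truncated curvature only sees
the even part of the kernel. -/
theorem truncFracCurvature_eq_symKernel (hE : NullMeasurableSet E volume) {s ρ : ℝ} (hs : 0 < s)
    (hρ : 0 < ρ) (x : RSpace n) :
    truncFracCurvature s E x ρ = ∫ w in (Metric.ball 0 ρ)ᶜ, symKernel s E x w := by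
  have hint := integrableOn_translate_kernel hE hs hρ x
  have hneg : IntegrableOn (fun w => sideSign E (x - w) * ‖w‖ ^ (-((n : ℝ) + s)))
      (Metric.ball 0 ρ)ᶜ ∧
      ∫ w in (Metric.ball 0 ρ)ᶜ, sideSign E (x - w) * ‖w‖ ^ (-((n : ℝ) + s)) =
        ∫ w in (Metric.ball 0 ρ)ᶜ, sideSign E (x + w) * ‖w‖ ^ (-((n : ℝ) + s)) := by
    have hind : ∀ w, (Metric.ball 0 ρ)ᶜ.indicator
        (fun w => sideSign E (x - w) * ‖w‖ ^ (-((n : ℝ) + s))) w =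
        (Metric.ball 0 ρ)ᶜ.indicator
        (fun w => sideSign E (x + w) * ‖w‖ ^ (-((n : ℝ) + s))) (-w) := by
      intro w
      simp [indicator, sub_eq_add_neg]
    constructor
    · rw [← integrable_indicator_iff measurableSet_ball.compl] at hint ⊢
      exact hint.comp_neg.congr (Eventually.of_forall fun w => (hind w).symm)
    · rw [← integral_indicator measurableSet_ball.compl,
        ← integral_indicator measurableSet_ball.compl,
        integral_congr_ae (Eventually.of_forall hind), integral_neg_eq_self
          ((Metric.ball 0 ρ)ᶜ.indicator
            (fun w => sideSign E (x + w) * ‖w‖ ^ (-((n : ℝ) + s))))]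
  have hsym : ∀ w, symKernel s E x w = (2 : ℝ)⁻¹ *
      (sideSign E (x + w) * ‖w‖ ^ (-((n : ℝ) + s)) +
        sideSign E (x - w) * ‖w‖ ^ (-((n : ℝ) + s))) := by
    intro w; rw [symKernel]; ring
  simp_rw [hsym]
  rw [integral_const_mul, integral_add hint hneg.1, hneg.2, truncFracCurvature_eq_translate]
  ring

theorem integrableOn_symKernel_compl (hE : NullMeasurableSet E volume) {s ρ : ℝ} (hs : 0 < s)
    (hρ : 0 < ρ) (x : RSpace n) : IntegrableOn (symKernel s E x) (Metric.ball 0 ρ)ᶜ :=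
  Integrable.mono' (integrableOn_norm_rpow_compl_ball n hs hρ).1
    (aestronglyMeasurable_symKernel hE s x).restrict
    (Eventually.of_forall fun w => abs_symKernel_le s E x w)

/-- When the symmetrized kernel is integrable near the origin, the principal value exists and is
an absolutely convergent integral. -/
theorem hasFracCurvature_of_integrableOn (hE : NullMeasurableSet E volume) {s η : ℝ} (hs : 0 < s)
    (hη : 0 < η) {x : RSpace n} (hint : IntegrableOn (symKernel s E x) (Metric.ball 0 η)) :
    HasFracCurvature s E x (fracCurvature s E x) ∧ Integrable (symKernel s E x) ∧
      fracCurvature s E x = ∫ w, symKernel s E x w := by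
  have hI : Integrable (symKernel s E x) := by
    rw [← integrableOn_univ, ← union_compl_self (Metric.ball (0 : RSpace n) η)]
    exact hint.union (integrableOn_symKernel_compl hE hs hη x)
  have hlim : Tendsto (truncFracCurvature s E x) (𝓝[>] 0) (𝓝 (∫ w, symKernel s E x w)) := by
    have h1 : Tendsto (fun ρ : ℝ => ∫ w, (Metric.ball 0 ρ)ᶜ.indicator (symKernel s E x) w)
        (𝓝[>] 0) (𝓝 (∫ w, symKernel s E x w)) := by
      refine tendsto_integral_filter_of_dominated_convergence (fun w => ‖symKernel s E x w‖)
        (Eventually.of_forall fun ρ => hI.aestronglyMeasurable.indicator measurableSet_ball.compl)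
        (Eventually.of_forall fun ρ => Eventually.of_forall fun w => ?_) hI.norm ?_
      · exact norm_indicator_le_norm_self _ _
      · refine Eventually.of_forall fun w => ?_
        rcases eq_or_ne w 0 with rfl | hw
        · have h0 : symKernel s E x 0 = 0 := by
            rcases Nat.eq_zero_or_pos n with rfl | hn
            · rw [symKernel, norm_zero, Real.zero_rpow (by simpa using hs.ne'), mul_zero]
            · rw [symKernel, norm_zero, Real.zero_rpow (by
                have : (0 : ℝ) < n := by exact_mod_cast hn
                linarith), mul_zero]
          refine tendsto_const_nhds.congr fun ρ => ?_
          simp only [indicator]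
          split_ifs <;> simp [h0]
        · refine tendsto_const_nhds.congr' ?_
          have : ∀ᶠ ρ : ℝ in 𝓝[>] 0, ρ < ‖w‖ :=
            nhdsWithin_le_nhds (eventually_lt_nhds (norm_pos_iff.2 hw))
          filter_upwards [this] with ρ hρ
          rw [indicator_of_mem]
          simpa using hρ.le
    refine h1.congr' ?_
    filter_upwards [self_mem_nhdsWithin] with ρ hρ
    rw [truncFracCurvature_eq_symKernel hE hs hρ, integral_indicator measurableSet_ball.compl]
  have heq : fracCurvature s E x = ∫ w, symKernel s E x w := hlim.limUnder_eq
  exact ⟨⟨fun ρ hρ => integrableOn_fracKernel hE hs hρ x, heq ▸ hlim⟩, hI, heq⟩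

/-- The truncated curvature differs from the principal value by the integral of the symmetrized
kernel over the removed ball. -/
theorem fracCurvature_sub_trunc (hE : NullMeasurableSet E volume) {s η : ℝ} (hs : 0 < s)
    (hη : 0 < η) {x : RSpace n} (hint : IntegrableOn (symKernel s E x) (Metric.ball 0 η)) :
    fracCurvature s E x - truncFracCurvature s E x η =
      ∫ w in Metric.ball 0 η, symKernel s E x w := by
  obtain ⟨-, hI, heq⟩ := hasFracCurvature_of_integrableOn hE hs hη hint
  rw [heq, truncFracCurvature_eq_symKernel hE hs hη,
    ← integral_add_compl (measurableSet_ball (x := (0 : RSpace n)) (ε := η)) hI]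
  ring

/-- Comparison of a shifted kernel away from its singularity with an integrable power. -/
theorem norm_rpow_neg_le_of_dist_le {η p q : ℝ} (hη : 0 < η) (hq : 0 ≤ q) (hqp : q ≤ p)
    {x x₀ y : RSpace n} (hx : ‖x - x₀‖ ≤ η) (hy : η ≤ ‖y - x‖) :
    ‖y - x‖ ^ (-p) ≤ ((1 + 2 * η) / η) ^ p * (1 + ‖y - x₀‖) ^ (-q) := by
  have h1 : 1 + ‖y - x₀‖ ≤ (1 + 2 * η) / η * ‖y - x‖ := by
    have h2 : ‖y - x₀‖ ≤ ‖y - x‖ + ‖x - x₀‖ := norm_sub_le_norm_sub_add_norm_sub y x x₀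
    rw [div_mul_eq_mul_div, le_div_iff₀ hη]
    nlinarith
  have h0 : 0 < ‖y - x‖ := hη.trans_le hy
  have hc : 0 < (1 + 2 * η) / η := by positivity
  have h3 : 0 < 1 + ‖y - x₀‖ := by positivity
  calc ‖y - x‖ ^ (-p) = ((1 + 2 * η) / η) ^ p * ((1 + 2 * η) / η * ‖y - x‖) ^ (-p) := by
        rw [Real.mul_rpow hc.le h0.le, ← mul_assoc, ← Real.rpow_add hc]; simp
    _ ≤ ((1 + 2 * η) / η) ^ p * (1 + ‖y - x₀‖) ^ (-p) := by
        gcongr ?_ * ?_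
        exact Real.rpow_le_rpow_of_nonpos h3 h1 (by linarith)
    _ ≤ _ := by
        gcongr ?_ * ?_
        exact Real.rpow_le_rpow_of_exponent_le (by linarith [norm_nonneg (y - x₀)]) (by linarith)

/-- Spheres are null sets, so the cut-off at radius `η` is continuous at almost every point. -/
theorem ae_norm_sub_ne (x₀ : RSpace n) {η : ℝ} (hη : 0 < η) :
    ∀ᵐ y : RSpace n, ‖y - x₀‖ ≠ η := by
  have h : volume (Metric.sphere x₀ η) = 0 := Measure.addHaar_sphere_of_ne_zero volume x₀ hη.ne'
  have h2 := measure_eq_zero_iff_ae_notMem.1 h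
  filter_upwards [h2] with y hy
  simpa [mem_sphere_iff_norm] using hy

/-- Away from the diagonal, the integral depends continuously on the order and the base point,
whatever the set is: the translation acts on the kernel only. -/
theorem continuousAt_truncFracCurvature (hE : NullMeasurableSet E volume) {s₀ η : ℝ} (hs : 0 < s₀)
    (hη : 0 < η) (x₀ : RSpace n) :
    ContinuousAt (fun q : ℝ × RSpace n => truncFracCurvature q.1 E q.2 η) (s₀, x₀) := by
  have heq : (fun q : ℝ × RSpace n => truncFracCurvature q.1 E q.2 η) =
      fun q => ∫ y, (Metric.ball q.2 η)ᶜ.indicator (fracKernel q.1 E q.2) y := by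
    ext q
    rw [truncFracCurvature, integral_indicator measurableSet_ball.compl]
  rw [heq]
  have hev : ∀ᶠ q : ℝ × RSpace n in 𝓝 (s₀, x₀), (s₀ / 2 < q.1 ∧ q.1 < s₀ + 1) ∧
      ‖q.2 - x₀‖ < η := by
    refine (((continuous_fst.tendsto (s₀, x₀)).eventually (lt_mem_nhds (by simpa using hs))).and
      ((continuous_fst.tendsto (s₀, x₀)).eventually (gt_mem_nhds (by simp)))).and ?_
    have : Tendsto (fun q : ℝ × RSpace n => ‖q.2 - x₀‖) (𝓝 (s₀, x₀)) (𝓝 ‖x₀ - x₀‖) :=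
      ((continuous_snd.sub continuous_const).norm).tendsto _
    rw [sub_self, norm_zero] at this
    exact this.eventually (gt_mem_nhds hη)
  have hmeas : ∀ q : ℝ × RSpace n, AEStronglyMeasurable
      ((Metric.ball q.2 η)ᶜ.indicator (fracKernel q.1 E q.2)) := by
    intro q
    refine AEStronglyMeasurable.indicator ?_ measurableSet_ball.compl
    have : fracKernel q.1 E q.2 = fun y => sideSign E y * ‖y - q.2‖ ^ (-((n : ℝ) + q.1)) := by
      ext y; exact fracKernel_eq _ _ _ _
    rw [this]
    exact (aestronglyMeasurable_sideSign hE).mul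
      (((measurable_id.sub_const q.2).norm.pow_const _).aestronglyMeasurable)
  refine tendsto_integral_filter_of_dominated_convergence
    (fun y => ((1 + 2 * η) / η) ^ ((n : ℝ) + (s₀ + 1)) *
      (1 + ‖y - x₀‖) ^ (-((n : ℝ) + s₀ / 2)))
    (Eventually.of_forall hmeas) ?_ ?_ ?_
  · filter_upwards [hev] with q hq
    refine Eventually.of_forall fun y => ?_
    rw [indicator]
    split_ifs with hy
    · have hy' : η ≤ ‖y - q.2‖ := by simpa [dist_eq_norm] using hy
      rw [fracKernel_eq, Real.norm_eq_abs, abs_mul,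
        abs_of_nonneg (Real.rpow_nonneg (norm_nonneg _) _)]
      refine (mul_le_of_le_one_left (Real.rpow_nonneg (norm_nonneg _) _)
        (abs_sideSign_le _ _)).trans ?_
      refine (norm_rpow_neg_le_of_dist_le (q := n + s₀ / 2) hη (by positivity)
        (by linarith [hq.1.1]) hq.2.le hy').trans ?_
      gcongr ?_ * _
      refine Real.rpow_le_rpow_of_exponent_le ?_ (by linarith [hq.1.2])
      rw [le_div_iff₀ hη]; linarith
    · rw [norm_zero]; positivity
  · have := integrable_one_add_norm (μ := (volume : Measure (RSpace n)))
      (r := n + s₀ / 2) (by simpa using hs)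
    exact (this.comp_sub_right x₀).const_mul _
  · filter_upwards [ae_norm_sub_ne x₀ hη] with y hy
    have hnorm : Tendsto (fun q : ℝ × RSpace n => ‖y - q.2‖) (𝓝 (s₀, x₀)) (𝓝 ‖y - x₀‖) :=
      ((continuous_const.sub continuous_snd).norm).tendsto (s₀, x₀)
    rcases lt_or_gt_of_ne hy with h | h
    · have : ∀ᶠ q : ℝ × RSpace n in 𝓝 (s₀, x₀), ‖y - q.2‖ < η :=
        hnorm.eventually (gt_mem_nhds h)
      rw [indicator_of_notMem (by simpa [dist_eq_norm] using h)]
      refine tendsto_const_nhds.congr' ?_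
      filter_upwards [this] with q hq
      rw [indicator_of_notMem (by simpa [dist_eq_norm] using hq)]
    · have : ∀ᶠ q : ℝ × RSpace n in 𝓝 (s₀, x₀), η < ‖y - q.2‖ :=
        hnorm.eventually (lt_mem_nhds h)
      rw [indicator_of_mem (by simpa [dist_eq_norm] using h.le), fracKernel_eq]
      have hk : Tendsto (fun q : ℝ × RSpace n => sideSign E y * ‖y - q.2‖ ^ (-((n : ℝ) + q.1)))
          (𝓝 (s₀, x₀)) (𝓝 (sideSign E y * ‖y - x₀‖ ^ (-((n : ℝ) + s₀)))) := by
        refine tendsto_const_nhds.mul (hnorm.rpow ?_ (Or.inl (hη.trans h).ne'))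
        exact ((continuous_const.add continuous_fst).neg).tendsto (s₀, x₀)
      refine hk.congr' ?_
      filter_upwards [this] with q hq
      rw [indicator_of_mem (by simpa [dist_eq_norm] using hq.le), fracKernel_eq]

end

/-! ### Adapted orthonormal coordinates -/

theorem OrthoCoords.pos {n : ℕ} (Φ : OrthoCoords n) : 0 < n := by
  rcases Nat.eq_zero_or_pos n with rfl | h
  · exfalso
    have h1 : Φ.symm (WithLp.toLp 2 (0, 1)) = Φ.symm 0 := Subsingleton.elim _ _
    have h2 := congrArg WithLp.snd (Φ.symm.injective h1)
    simp at h2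
  · exact h

theorem OrthoCoords.cast_pred_add_one {n : ℕ} (Φ : OrthoCoords n) :
    ((n - 1 : ℕ) : ℝ) + 1 = n := by
  have := Φ.pos
  rw [Nat.cast_sub this]; simp

/-- A unit vector is the last vector of some orthonormal frame: reflect a given frame in the
hyperplane that exchanges its last vector with the given one. -/
theorem OrthoCoords.exists_map_eq {n : ℕ} (Φ : OrthoCoords n) {ν : RSpace n} (hν : ‖ν‖ = 1) :
    ∃ Ψ : OrthoCoords n, Ψ ν = WithLp.toLp 2 (0, 1) := by
  have h : ‖Φ ν‖ = ‖(WithLp.toLp 2 (0, 1) : WithLp 2 (RSpace (n - 1) × ℝ))‖ := by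
    rw [Φ.norm_map, hν, ← sq_eq_sq₀ zero_le_one (norm_nonneg _), WithLp.prod_norm_sq_eq_of_L2]
    simp
  exact ⟨Φ.trans (Submodule.reflection (ℝ ∙ (Φ ν - WithLp.toLp 2 (0, 1)))ᗮ),
    Submodule.reflection_sub h⟩

theorem OrthoCoords.snd_eq_inner {n : ℕ} {Ψ : OrthoCoords n} {ν : RSpace n}
    (h : Ψ ν = WithLp.toLp 2 (0, 1)) (w : RSpace n) : (Ψ w).snd = inner ℝ w ν := by
  rw [← Ψ.inner_map_map, h, WithLp.prod_inner_apply]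
  simp

theorem OrthoCoords.norm_sq_eq {n : ℕ} (Ψ : OrthoCoords n) (w : RSpace n) :
    ‖w‖ ^ 2 = ‖(Ψ w).fst‖ ^ 2 + (Ψ w).snd ^ 2 := by
  rw [← Ψ.norm_map, WithLp.prod_norm_sq_eq_of_L2, Real.norm_eq_abs, sq_abs]

theorem OrthoCoords.norm_fst_le {n : ℕ} (Ψ : OrthoCoords n) (w : RSpace n) :
    ‖(Ψ w).fst‖ ≤ ‖w‖ :=
  abs_le_of_sq_le_sq' (by nlinarith [Ψ.norm_sq_eq w, sq_nonneg (Ψ w).snd]) (norm_nonneg w) |>.2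

theorem OrthoCoords.abs_snd_le {n : ℕ} (Ψ : OrthoCoords n) (w : RSpace n) :
    |(Ψ w).snd| ≤ ‖w‖ :=
  abs_le_of_sq_le_sq (by nlinarith [Ψ.norm_sq_eq w, sq_nonneg ‖(Ψ w).fst‖]) (norm_nonneg w)

theorem OrthoCoords.norm_le_add {n : ℕ} (Ψ : OrthoCoords n) (w : RSpace n) :
    ‖w‖ ≤ ‖(Ψ w).fst‖ + |(Ψ w).snd| := by
  refine (abs_le_of_sq_le_sq' ?_ (by positivity)).2
  have := sq_abs (Ψ w).snd
  nlinarith [Ψ.norm_sq_eq w, mul_nonneg (norm_nonneg (Ψ w).fst) (abs_nonneg (Ψ w).snd)]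

theorem OrthoCoords.measurePreserving_prodMk {n : ℕ} (Ψ : OrthoCoords n) :
    MeasurePreserving (fun w : RSpace n => ((Ψ w).fst, (Ψ w).snd)) :=
  (WithLp.volume_preserving_ofLp (U := RSpace (n - 1)) (V := ℝ)).comp
    (LinearIsometryEquiv.measurePreserving Ψ)

theorem OrthoCoords.integrable_comp_and_integral {n : ℕ} (Ψ : OrthoCoords n)
    {F : RSpace (n - 1) × ℝ → ℝ} (hF : Integrable F) :
    Integrable (fun w => F ((Ψ w).fst, (Ψ w).snd)) ∧
      ∫ w, F ((Ψ w).fst, (Ψ w).snd) = ∫ z, F z := by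
  refine ⟨(Ψ.measurePreserving_prodMk.integrable_comp hF.aestronglyMeasurable).2 hF, ?_⟩
  rw [← Ψ.measurePreserving_prodMk.map_eq,
    integral_map Ψ.measurePreserving_prodMk.measurable.aemeasurable]
  rw [Ψ.measurePreserving_prodMk.map_eq]
  exact hF.aestronglyMeasurable

/-! ### Thin slabs around a graph -/

/-- The weight `|y|^{-(m+1+s)}` on the set of `(y, t)` with `|y| < η` that lie within `κ |y|^{1+γ}`
of the graph of `c`. -/
noncomputable def slabWeight {m : ℕ} (c : RSpace m → ℝ) (κ γ s η : ℝ) (z : RSpace m × ℝ) : ℝ :=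
  {z : RSpace m × ℝ | ‖z.1‖ < η ∧ |z.2 - c z.1| ≤ κ * ‖z.1‖ ^ (1 + γ)}.indicator
    (fun z => ‖z.1‖ ^ (-((m : ℝ) + 1 + s))) z

theorem slabWeight_nonneg {m : ℕ} (c : RSpace m → ℝ) (κ γ s η : ℝ) (z : RSpace m × ℝ) :
    0 ≤ slabWeight c κ γ s η z :=
  indicator_nonneg (fun _ _ => Real.rpow_nonneg (norm_nonneg _) _) z

theorem slabWeight_of_mem {m : ℕ} {c : RSpace m → ℝ} {κ γ s η : ℝ} {y : RSpace m} {t : ℝ}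
    (hy : ‖y‖ < η) (ht : |t - c y| ≤ κ * ‖y‖ ^ (1 + γ)) :
    slabWeight c κ γ s η (y, t) = ‖y‖ ^ (-((m : ℝ) + 1 + s)) := by
  rw [slabWeight, indicator_of_mem]
  exact ⟨hy, ht⟩

theorem measurable_slabWeight {m : ℕ} {c : RSpace m → ℝ} (hc : Measurable c) (κ γ s η : ℝ) :
    Measurable (slabWeight c κ γ s η) := by
  refine Measurable.indicator (measurable_fst.norm.pow_const _) ?_
  exact (measurableSet_lt measurable_fst.norm measurable_const).inter
    (measurableSet_le (f := fun z : RSpace m × ℝ => |z.2 - c z.1|)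
      (measurable_snd.sub (hc.comp measurable_fst)).abs
      ((measurable_fst.norm.pow_const _).const_mul _))

theorem slabWeight_fiber {m : ℕ} (c : RSpace m → ℝ) (κ γ s η : ℝ) (y : RSpace m) :
    (fun t => slabWeight c κ γ s η (y, t)) =
      (Icc (c y - κ * ‖y‖ ^ (1 + γ)) (c y + κ * ‖y‖ ^ (1 + γ))).indicator
        (fun _ => (Metric.ball 0 η).indicator (fun y => ‖y‖ ^ (-((m : ℝ) + 1 + s))) y) := by
  ext t
  simp only [slabWeight, indicator, mem_ofPred_eq, mem_Icc, Metric.mem_ball, dist_zero_right,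
    abs_le]
  by_cases h1 : ‖y‖ < η
  · simp only [h1, true_and, if_true]
    refine if_congr ⟨fun h => ⟨by linarith [h.1], by linarith [h.2]⟩,
      fun h => ⟨by linarith [h.1], by linarith [h.2]⟩⟩ rfl rfl
  · simp [h1]

/-- A fibre of the slab has length `2 κ |y|^{1+γ}`, which turns the weight into `|y|^{γ-s-m}`. Only
an inequality is claimed: at `y = 0` the power on the right is `1` when its exponent vanishes. -/
theorem integral_slabWeight_fiber_le {m : ℕ} (c : RSpace m → ℝ) {κ γ s : ℝ} (hκ : 0 ≤ κ)
    (hγ : 0 < 1 + γ) (η : ℝ) (y : RSpace m) :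
    ∫ t, slabWeight c κ γ s η (y, t) ≤
      2 * κ * (Metric.ball 0 η).indicator (fun y => ‖y‖ ^ ((γ - s) - m)) y := by
  rw [slabWeight_fiber, integral_indicator measurableSet_Icc, setIntegral_const, smul_eq_mul,
    Real.volume_real_Icc_of_le (by nlinarith [Real.rpow_nonneg (norm_nonneg y) (1 + γ)])]
  simp only [indicator]
  split_ifs with h
  · rcases eq_or_ne y 0 with rfl | hy
    · rw [norm_zero, Real.zero_rpow hγ.ne']
      have : (0 : ℝ) ≤ 0 ^ (γ - s - m) := Real.rpow_nonneg le_rfl _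
      simp only [mul_zero, add_zero, sub_zero, sub_self, zero_mul]
      exact mul_nonneg (by positivity) this
    · have hy0 := norm_pos_iff.2 hy
      have : ‖y‖ ^ (γ - s - m) = ‖y‖ ^ (1 + γ) * ‖y‖ ^ (-((m : ℝ) + 1 + s)) := by
        rw [← Real.rpow_add hy0]; congr 1; ring
      rw [this]
      apply le_of_eq; ring
  · simp

/-- The slab has finite mass when its opening order `γ` exceeds `s`. -/
theorem integrable_slabWeight {m : ℕ} {c : RSpace m → ℝ} (hc : Measurable c) {κ γ s η : ℝ}
    (hκ : 0 ≤ κ) (hγ : 0 < 1 + γ) (hs : s < γ) (hη : 0 < η) :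
    Integrable (slabWeight c κ γ s η) ∧
      ∫ z, slabWeight c κ γ s η z ≤ 2 * κ * (sphereArea m * (η ^ (γ - s) / (γ - s))) := by
  have hball := (integrableOn_norm_rpow_ball m (sub_pos.2 hs) hη)
  rw [← integrable_indicator_iff measurableSet_ball] at hball
  have hmeas := (measurable_slabWeight hc κ γ s η)
  have hint : Integrable (slabWeight c κ γ s η) := by
    rw [Measure.volume_eq_prod, integrable_prod_iff hmeas.aestronglyMeasurable]
    constructor
    · refine Eventually.of_forall fun y => ?_
      rw [slabWeight_fiber]
      exact (integrable_indicator_iff measurableSet_Icc).2 (integrableOn_const (by simp))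
    · refine (hball.const_mul (2 * κ)).mono' ?_ (Eventually.of_forall fun y => ?_)
      · exact (hmeas.norm.stronglyMeasurable.integral_prod_right').aestronglyMeasurable
      · rw [Real.norm_of_nonneg (integral_nonneg fun _ => norm_nonneg _)]
        refine le_trans (le_of_eq ?_) (integral_slabWeight_fiber_le c hκ hγ η y)
        refine integral_congr_ae (Eventually.of_forall fun t => ?_)
        exact Real.norm_of_nonneg (slabWeight_nonneg _ _ _ _ _ _)
  refine ⟨hint, ?_⟩
  rw [Measure.volume_eq_prod] at hint ⊢
  rw [integral_prod _ hint, ← integral_norm_rpow_ball m (sub_pos.2 hs) hη,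
    ← integral_indicator measurableSet_ball, ← integral_const_mul]
  exact integral_mono hint.integral_prod_left (hball.const_mul _)
    fun y => integral_slabWeight_fiber_le c hκ hγ η y

/-! ### Pinched sets -/

/-- Within distance `δ` of `x`, the set `E` contains the points `x + w` whose height `⟪w, ν⟫`
exceeds `f w` by more than `g w`, and none of those whose height is below `f w` by more than
`g w`. -/
def IsPinched {n : ℕ} (E : Set (RSpace n)) (x ν : RSpace n) (f g : RSpace n → ℝ) (δ : ℝ) : Prop :=
  ∀ w : RSpace n, ‖w‖ < δ →
    (f w + g w < inner ℝ w ν → x + w ∈ E) ∧ (inner ℝ w ν < f w - g w → x + w ∉ E)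

/-- A set pinched between two paraboloids of order `1 + α` has opposite signs at `x ± w` unless `w`
is in a slab around the tangent hyperplane, and this slab has finite mass for the kernel when
`s < α`. -/
theorem integrableOn_symKernel_of_isPinched {n : ℕ} {E : Set (RSpace n)} (Φ : OrthoCoords n)
    (hE : NullMeasurableSet E volume) {x ν : RSpace n} (hν : ‖ν‖ = 1) {C α δ : ℝ} (hC : 0 ≤ C)
    (hα : 0 < α) (hα1 : α ≤ 1)
    (hpin : IsPinched E x ν (fun _ => 0) (fun w => C * ‖w‖ ^ (1 + α)) δ) {s η : ℝ}
    (hs : 0 < s) (hsα : s < α) (hη : 0 < η) (hηδ : η ≤ δ) (hsmall : C * η ^ α ≤ 1 / 2) :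
    IntegrableOn (symKernel s E x) (Metric.ball 0 η) ∧
      |∫ w in Metric.ball 0 η, symKernel s E x w| ≤
        8 * C * (sphereArea (n - 1) * (η ^ (α - s) / (α - s))) := by
  obtain ⟨Ψ, hΨ⟩ := Φ.exists_map_eq hν
  have hslab := integrable_slabWeight (m := n - 1) (c := fun _ => 0) measurable_const
    (κ := 4 * C) (γ := α) (s := s) (η := η) (by positivity) (by linarith) hsα hη
  obtain ⟨hcomp, hcompint⟩ := Ψ.integrable_comp_and_integral hslab.1
  have hpt : ∀ w ∈ Metric.ball (0 : RSpace n) η, ‖symKernel s E x w‖ ≤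
      slabWeight (fun _ => 0) (4 * C) α s η ((Ψ w).fst, (Ψ w).snd) := by
    intro w hw
    have hwη : ‖w‖ < η := by simpa using hw
    by_cases hz : symKernel s E x w = 0
    · rw [hz, norm_zero]; exact slabWeight_nonneg _ _ _ _ _ _
    have hw0 : w ≠ 0 := by
      rintro rfl
      apply hz
      have : (0 : ℝ) < n := by exact_mod_cast Φ.pos
      rw [symKernel, norm_zero, Real.zero_rpow (by linarith), mul_zero]
    have hwpos := norm_pos_iff.2 hw0
    have hp := hpin w (hwη.trans_le hηδ)
    have hm := hpin (-w) (by rw [norm_neg]; exact hwη.trans_le hηδ)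
    simp only [norm_neg, inner_neg_left, zero_add, zero_sub, ← sub_eq_add_neg] at hp hm
    have ht : |(Ψ w).snd| ≤ C * ‖w‖ ^ (1 + α) := by
      rw [OrthoCoords.snd_eq_inner hΨ]
      by_contra hcon
      apply hz
      rcases lt_abs.1 (not_le.1 hcon) with h | h
      · rw [symKernel, sideSign_of_mem (hp.1 h), sideSign_of_notMem (hm.2 (by linarith))]; simp
      · rw [symKernel, sideSign_of_notMem (hp.2 (by linarith)), sideSign_of_mem (hm.1 h)]; simp
    have h1 : C * ‖w‖ ^ (1 + α) ≤ ‖w‖ / 2 := by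
      rw [Real.rpow_add hwpos, Real.rpow_one]
      have : C * ‖w‖ ^ α ≤ 1 / 2 := le_trans (by gcongr) hsmall
      nlinarith
    have h2 : ‖w‖ ≤ 2 * ‖(Ψ w).fst‖ := by linarith [Ψ.norm_le_add w]
    have hy : 0 < ‖(Ψ w).fst‖ := by linarith
    rw [slabWeight_of_mem ((Ψ.norm_fst_le w).trans_lt hwη)]
    · refine (abs_symKernel_le s E x w).trans ?_
      rw [Φ.cast_pred_add_one]
      exact Real.rpow_le_rpow_of_nonpos hy (Ψ.norm_fst_le w)
        (by have : (0 : ℝ) ≤ n := n.cast_nonneg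
            linarith)
    · rw [sub_zero]
      calc |(Ψ w).snd| ≤ C * ‖w‖ ^ (1 + α) := ht
        _ ≤ C * (2 * ‖(Ψ w).fst‖) ^ (1 + α) := by gcongr
        _ = 2 ^ (1 + α) * C * ‖(Ψ w).fst‖ ^ (1 + α) := by
            rw [Real.mul_rpow (by norm_num) hy.le]; ring
        _ ≤ 4 * C * ‖(Ψ w).fst‖ ^ (1 + α) := by
            gcongr
            calc (2 : ℝ) ^ (1 + α) ≤ 2 ^ (2 : ℝ) :=
                  Real.rpow_le_rpow_of_exponent_le (by norm_num) (by linarith)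
              _ = 4 := by norm_num
  have hint : IntegrableOn (symKernel s E x) (Metric.ball 0 η) :=
    hcomp.integrableOn.mono' (aestronglyMeasurable_symKernel hE s x).restrict
      ((ae_restrict_iff' measurableSet_ball).2 (Eventually.of_forall hpt))
  refine ⟨hint, ?_⟩
  rw [← Real.norm_eq_abs]
  calc ‖∫ w in Metric.ball 0 η, symKernel s E x w‖
      ≤ ∫ w in Metric.ball 0 η, ‖symKernel s E x w‖ := norm_integral_le_integral_norm _
    _ ≤ ∫ w in Metric.ball 0 η, slabWeight (fun _ => 0) (4 * C) α s η ((Ψ w).fst, (Ψ w).snd) :=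
        setIntegral_mono_on hint.norm hcomp.integrableOn measurableSet_ball hpt
    _ ≤ ∫ w, slabWeight (fun _ => 0) (4 * C) α s η ((Ψ w).fst, (Ψ w).snd) :=
        setIntegral_le_integral hcomp (Eventually.of_forall fun w => slabWeight_nonneg _ _ _ _ _ _)
    _ ≤ _ := by
        rw [hcompint]
        refine hslab.2.trans (le_of_eq ?_)
        ring

/-! ### Graphs -/

/-- Boundary points in the cylinder lie on the graph, since the strict supergraph and the strict
subgraph are open. -/
theorem IsLocalSupergraph.snd_eq_of_mem_frontier {n : ℕ} {E : Set (RSpace n)} {x₀ x : RSpace n}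
    {Φ : OrthoCoords n} {r h : ℝ} {u : RSpace (n - 1) → ℝ} (hrep : IsLocalSupergraph E x₀ Φ r h u)
    (hu : ContinuousOn u (Metric.ball 0 r)) (hx : x ∈ frontier E)
    (h1 : ‖(Φ (x - x₀)).fst‖ < r) (h2 : |(Φ (x - x₀)).snd| < h) :
    (Φ (x - x₀)).snd = u (Φ (x - x₀)).fst := by
  obtain ⟨-, -, -, hE⟩ := hrep
  have hΦ : Continuous fun y : RSpace n => Φ (y - x₀) :=
    Φ.continuous.comp (continuous_id.sub continuous_const)
  have hf : Continuous fun y : RSpace n => (Φ (y - x₀)).fst :=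
    (WithLp.prod_continuous_ofLp 2 _ _).fst.comp hΦ
  have hs : Continuous fun y : RSpace n => (Φ (y - x₀)).snd :=
    (WithLp.prod_continuous_ofLp 2 _ _).snd.comp hΦ
  have e1 : ∀ᶠ y in 𝓝 x, ‖(Φ (y - x₀)).fst‖ < r :=
    hf.norm.continuousAt.eventually (gt_mem_nhds h1)
  have e2 : ∀ᶠ y in 𝓝 x, |(Φ (y - x₀)).snd| < h :=
    hs.abs.continuousAt.eventually (gt_mem_nhds h2)
  have hux : ContinuousAt (fun y : RSpace n => u (Φ (y - x₀)).fst) x :=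
    ContinuousAt.comp (f := fun y : RSpace n => (Φ (y - x₀)).fst)
      (hu.continuousAt (Metric.isOpen_ball.mem_nhds (by simpa using h1))) hf.continuousAt
  rcases lt_trichotomy (Φ (x - x₀)).snd (u (Φ (x - x₀)).fst) with hlt | heq | hgt
  · exfalso
    have e3 := hs.continuousAt.eventually_lt hux hlt
    have : Eᶜ ∈ 𝓝 x := by
      filter_upwards [e1, e2, e3] with y a b c using (hE y a b).2 c
    exact (mem_closure_iff_nhds.1 hx.1 _ this).ne_empty (by simp)
  · exact heq
  · exfalso
    have e3 := hux.eventually_lt hs.continuousAt hgt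
    have : E ∈ 𝓝 x := by
      filter_upwards [e1, e2, e3] with y a b c using (hE y a b).1 c
    exact hx.2 (mem_interior_iff_mem_nhds.2 this)

/-- The upward unit normal, in the coordinates `Φ`, of a graph of slope `b`. -/
noncomputable def graphNormal {n : ℕ} (Φ : OrthoCoords n) (b : RSpace (n - 1)) : RSpace n :=
  (Real.sqrt (1 + ‖b‖ ^ 2))⁻¹ • Φ.symm (WithLp.toLp 2 (-b, 1))

theorem one_le_sqrt_one_add_sq (a : ℝ) : 1 ≤ Real.sqrt (1 + a ^ 2) := by
  rw [Real.one_le_sqrt]; nlinarith [sq_nonneg a]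

theorem norm_graphNormal {n : ℕ} (Φ : OrthoCoords n) (b : RSpace (n - 1)) :
    ‖graphNormal Φ b‖ = 1 := by
  have h : ‖Φ.symm (WithLp.toLp 2 (-b, 1))‖ = Real.sqrt (1 + ‖b‖ ^ 2) := by
    rw [Φ.symm.norm_map, WithLp.prod_norm_eq_of_L2]
    simp [add_comm]
  have h1 := one_le_sqrt_one_add_sq ‖b‖
  rw [graphNormal, norm_smul, h, Real.norm_of_nonneg (by positivity)]
  exact inv_mul_cancel₀ (by linarith)

theorem inner_graphNormal {n : ℕ} (Φ : OrthoCoords n) (b : RSpace (n - 1)) (w : RSpace n) :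
    inner ℝ w (graphNormal Φ b) =
      (Real.sqrt (1 + ‖b‖ ^ 2))⁻¹ * ((Φ w).snd - inner ℝ b (Φ w).fst) := by
  rw [graphNormal, inner_smul_right, ← Φ.inner_map_map, Φ.apply_symm_apply,
    WithLp.prod_inner_apply]
  simp [real_inner_comm, sub_eq_neg_add]

theorem continuous_graphNormal {n : ℕ} (Φ : OrthoCoords n) : Continuous (graphNormal Φ) := by
  unfold graphNormal
  refine Continuous.smul (Continuous.inv₀
    (Real.continuous_sqrt.comp (continuous_const.add (continuous_norm.pow 2))) fun b => ?_) ?_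
  · exact (zero_lt_one.trans_le (one_le_sqrt_one_add_sq ‖b‖)).ne'
  · exact Φ.symm.continuous.comp
      ((WithLp.prod_continuous_toLp 2 _ _).comp (continuous_neg.prodMk continuous_const))

/-- A Taylor estimate for the function whose graph is the boundary, with height and error divided by
`√(1 + |∇u|²)`, is a pinching condition along the normal. -/
theorem IsLocalSupergraph.isPinched {n : ℕ} {E : Set (RSpace n)} {x₀ x : RSpace n}
    {Φ : OrthoCoords n} {r h : ℝ} {u : RSpace (n - 1) → ℝ} (hrep : IsLocalSupergraph E x₀ Φ r h u)
    (h1 : ‖(Φ (x - x₀)).fst‖ < r / 2) (h2 : |(Φ (x - x₀)).snd| < h / 2)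
    (hx : (Φ (x - x₀)).snd = u (Φ (x - x₀)).fst) (b : RSpace (n - 1)) {f g : RSpace n → ℝ} {δ : ℝ}
    (hr : δ ≤ r / 2) (hh : δ ≤ h / 2)
    (H : ∀ w : RSpace n, ‖w‖ < δ →
      |u ((Φ (x - x₀)).fst + (Φ w).fst) - u (Φ (x - x₀)).fst - inner ℝ b (Φ w).fst -
        Real.sqrt (1 + ‖b‖ ^ 2) * f w| ≤ Real.sqrt (1 + ‖b‖ ^ 2) * g w) :
    IsPinched E x (graphNormal Φ b) f g δ := by
  obtain ⟨-, -, -, hE⟩ := hrep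
  intro w hw
  have hJ : 0 < Real.sqrt (1 + ‖b‖ ^ 2) := by linarith [one_le_sqrt_one_add_sq ‖b‖]
  have hxw : Φ (x + w - x₀) = Φ (x - x₀) + Φ w := by
    rw [← Φ.map_add]; congr 1; abel
  have key := hE (x + w)
  rw [hxw, WithLp.add_fst, WithLp.add_snd, hx] at key
  have k := key
    ((norm_add_le _ _).trans_lt (by linarith [Φ.norm_fst_le w]))
    ((abs_add_le _ _).trans_lt (by rw [hx] at h2; linarith [Φ.abs_snd_le w]))
  have hH := abs_le.1 (H w hw)
  rw [inner_graphNormal]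
  constructor
  · intro hlt
    rw [inv_mul_eq_div, lt_div_iff₀ hJ] at hlt
    exact k.1 (by linarith)
  · intro hlt
    rw [inv_mul_eq_div, div_lt_iff₀ hJ] at hlt
    exact k.2 (by linarith)

/-- A Taylor estimate that only uses the gradient along a segment. -/
theorem abs_taylor_le {m : ℕ} {u : RSpace m → ℝ} {a w b : RSpace m} (D : RSpace m →L[ℝ] RSpace m)
    {M : ℝ} (hu : ∀ t ∈ Icc (0 : ℝ) 1, DifferentiableAt ℝ u (a + t • w))
    (hM : ∀ t ∈ Icc (0 : ℝ) 1, ‖gradient u (a + t • w) - b - t • D w‖ * ‖w‖ ≤ M) :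
    |u (a + w) - u a - inner ℝ b w - 2⁻¹ * inner ℝ (D w) w| ≤ M := by
  have hd : ∀ t ∈ Icc (0 : ℝ) 1, HasDerivWithinAt
      (fun t : ℝ => u (a + t • w) - t * inner ℝ b w - 2⁻¹ * (t * t) * inner ℝ (D w) w)
      (inner ℝ (gradient u (a + t • w) - b - t • D w) w) (Icc 0 1) t := by
    intro t ht
    have h1 : HasDerivAt (fun t : ℝ => a + t • w) w t := by
      simpa using ((hasDerivAt_id t).smul_const w).const_add a
    have h2 := (hu t ht).hasGradientAt.hasFDerivAt.comp_hasDerivAt t h1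
    have h3 : HasDerivAt (fun t : ℝ => t * inner ℝ b w) (inner ℝ b w) t := by
      simpa using (hasDerivAt_id t).mul_const (inner ℝ b w)
    have h4 : HasDerivAt (fun t : ℝ => 2⁻¹ * (t * t) * inner ℝ (D w) w)
        (t * inner ℝ (D w) w) t := by
      have := (((hasDerivAt_id t).mul (hasDerivAt_id t)).const_mul (2⁻¹ : ℝ)).mul_const
        (inner ℝ (D w) w)
      refine this.congr_deriv ?_
      simp only [id]; ring
    refine (((h2.sub h3).sub h4).congr_deriv ?_).hasDerivWithinAt
    rw [inner_sub_left, inner_sub_left, inner_smul_left]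
    simp
  have := norm_image_sub_le_of_norm_deriv_le_segment_01' hd (C := M) (fun t ht => by
    refine (norm_inner_le_norm _ _).trans (hM t ⟨ht.1, ht.2.le⟩))
  rw [Real.norm_eq_abs] at this
  convert this using 2
  simp
  ring

/-- Near a point where the boundary is the graph of a `C^{1,α}` function, the set is pinched at
every boundary point between paraboloids of order `1 + α`, with uniform constants. -/
theorem exists_isPinched_of_holder {n : ℕ} {E : Set (RSpace n)} {x₀ : RSpace n}
    {Φ : OrthoCoords n} {r h : ℝ} {u : RSpace (n - 1) → ℝ} (hrep : IsLocalSupergraph E x₀ Φ r h u)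
    (hu : ContDiffOn ℝ 1 u (Metric.ball 0 r)) {α C : ℝ} (hα : 0 < α)
    (hC : ∀ z ∈ Metric.ball (0 : RSpace (n - 1)) r, ∀ w ∈ Metric.ball (0 : RSpace (n - 1)) r,
      ‖gradient u z - gradient u w‖ ≤ C * ‖z - w‖ ^ α) :
    ∃ K δ : ℝ, 0 ≤ K ∧ 0 < δ ∧ ∀ x ∈ frontier E, ‖x - x₀‖ < δ → ∃ ν : RSpace n, ‖ν‖ = 1 ∧
      IsPinched E x ν (fun _ => 0) (fun w => K * ‖w‖ ^ (1 + α)) δ := by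
  have hr := hrep.1
  have hh := hrep.2.1
  refine ⟨max C 0, min (r / 2) (h / 2), le_max_right _ _, by positivity, fun x hx hxδ => ?_⟩
  have hd1 : ‖(Φ (x - x₀)).fst‖ < r / 2 :=
    (Φ.norm_fst_le _).trans_lt (hxδ.trans_le (min_le_left _ _))
  have hd2 : |(Φ (x - x₀)).snd| < h / 2 :=
    (Φ.abs_snd_le _).trans_lt (hxδ.trans_le (min_le_right _ _))
  have heq := hrep.snd_eq_of_mem_frontier hu.continuousOn hx (by linarith) (by linarith)
  refine ⟨_, norm_graphNormal Φ (gradient u (Φ (x - x₀)).fst),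
    hrep.isPinched hd1 hd2 heq _ (min_le_left _ _) (min_le_right _ _) fun w hw => ?_⟩
  have hJ := one_le_sqrt_one_add_sq ‖gradient u (Φ (x - x₀)).fst‖
  have hw1 : ‖(Φ w).fst‖ < r / 2 := (Φ.norm_fst_le w).trans_lt (hw.trans_le (min_le_left _ _))
  have hball : ∀ t ∈ Icc (0 : ℝ) 1, (Φ (x - x₀)).fst + t • (Φ w).fst ∈
      Metric.ball (0 : RSpace (n - 1)) r := by
    intro t ht
    rw [mem_ball_zero_iff]
    refine (norm_add_le _ _).trans_lt ?_
    rw [norm_smul, Real.norm_of_nonneg ht.1]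
    nlinarith [norm_nonneg (Φ w).fst, ht.2]
  have key := abs_taylor_le (u := u) (a := (Φ (x - x₀)).fst) (w := (Φ w).fst)
    (b := gradient u (Φ (x - x₀)).fst) 0 (M := max C 0 * ‖w‖ ^ (1 + α))
    (fun t ht => (hu.differentiableOn one_ne_zero).differentiableAt
      (Metric.isOpen_ball.mem_nhds (hball t ht))) (fun t ht => ?_)
  · simp only [zero_apply, inner_zero_left, mul_zero, sub_zero] at key ⊢
    refine key.trans (le_mul_of_one_le_left (by positivity) hJ)
  · have h0 := hC _ (hball t ht) (Φ (x - x₀)).fst (by rw [mem_ball_zero_iff]; linarith)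
    simp only [zero_apply, smul_zero, sub_zero]
    rw [add_sub_cancel_left] at h0
    have h1 : ‖t • (Φ w).fst‖ ≤ ‖w‖ := by
      rw [norm_smul, Real.norm_of_nonneg ht.1]
      nlinarith [norm_nonneg (Φ w).fst, ht.2, Φ.norm_fst_le w]
    calc _ ≤ (max C 0 * ‖w‖ ^ α) * ‖w‖ := by
          gcongr
          · refine h0.trans ?_
            gcongr
            exact le_max_left _ _
          · exact Φ.norm_fst_le w
      _ = max C 0 * ‖w‖ ^ (1 + α) := by
          rcases eq_or_ne w 0 with rfl | hw0
          · rw [norm_zero, mul_zero, Real.zero_rpow (by positivity : 1 + α ≠ 0), mul_zero]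
          · rw [Real.rpow_add (norm_pos_iff.2 hw0), Real.rpow_one]; ring

theorem contDiffOn_gradient {m : ℕ} {u : RSpace m → ℝ} {r : ℝ}
    (hu : ContDiffOn ℝ 2 u (Metric.ball 0 r)) : ContDiffOn ℝ 1 (gradient u) (Metric.ball 0 r) := by
  have h := hu.fderiv_of_isOpen Metric.isOpen_ball (m := 1) (by norm_num)
  have hD := (InnerProductSpace.toDual ℝ (RSpace m)).symm.toContinuousLinearEquiv.contDiff (n := 1)
  exact hD.comp_contDiffOn h

/-- A `C²` boundary is a `C^{1,1}` boundary: gradients are Lipschitz on smaller balls. -/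
theorem IsC2BoundaryIn.isC1HolderBoundaryIn {n : ℕ} {E U : Set (RSpace n)}
    (hE : IsC2BoundaryIn E U) : IsC1HolderBoundaryIn E 1 U := by
  intro x hx
  obtain ⟨Φ, r, h, u, ⟨hr, hh, hu0, hrep⟩, hu⟩ := hE x hx
  have hg : ContDiffAt ℝ 1 (gradient u) 0 :=
    (contDiffOn_gradient hu).contDiffAt (Metric.isOpen_ball.mem_nhds (by simpa using hr))
  obtain ⟨K, t, ht, hK⟩ := hg.exists_lipschitzOnWith
  obtain ⟨ρ, hρ, hρt⟩ := Metric.mem_nhds_iff.1 ht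
  refine ⟨Φ, min r ρ, h, u, ⟨lt_min hr hρ, hh, hu0, fun y h1 h2 =>
    hrep y (h1.trans_le (min_le_left _ _)) h2⟩,
    (hu.of_le (by norm_num)).mono (Metric.ball_subset_ball (min_le_left _ _)), K, ?_⟩
  intro z hz w hw
  rw [Real.rpow_one]
  have hsub : Metric.ball (0 : RSpace (n - 1)) (min r ρ) ⊆ t :=
    (Metric.ball_subset_ball (min_le_right _ _)).trans hρt
  exact hK.norm_sub_le (hsub hz) (hsub hw)

/-! ### Uniform approximation by the truncated curvature -/

/-- Near a boundary point, the hypothesis of `integrableOn_symKernel_of_isPinched` holds with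
uniform constants. -/
theorem IsC1HolderBoundaryIn.exists_uniform_isPinched {n : ℕ} {E U : Set (RSpace n)} {α : ℝ}
    (hα : 0 < α) (hreg : IsC1HolderBoundaryIn E α U) {x₀ : RSpace n} (hx₀ : x₀ ∈ frontier E ∩ U) :
    Nonempty (OrthoCoords n) ∧ ∃ K δ : ℝ, 0 ≤ K ∧ 0 < δ ∧ δ ≤ 1 ∧ K * δ ^ α ≤ 1 / 2 ∧
      ∀ x ∈ frontier E, ‖x - x₀‖ < δ → ∃ ν : RSpace n, ‖ν‖ = 1 ∧
        IsPinched E x ν (fun _ => 0) (fun w => K * ‖w‖ ^ (1 + α)) δ := by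
  obtain ⟨Φ, r, h, u, hrep, hu, C, hC⟩ := hreg x₀ hx₀
  refine ⟨⟨Φ⟩, ?_⟩
  obtain ⟨K, δ, hK, hδ, H⟩ := exists_isPinched_of_holder hrep hu hα hC
  have hlim : Tendsto (fun t : ℝ => K * t ^ α) (𝓝[>] 0) (𝓝 0) := by
    have : Tendsto (fun t : ℝ => K * t ^ α) (𝓝 0) (𝓝 (K * 0 ^ α)) :=
      ((Real.continuousAt_rpow_const 0 α (Or.inr hα.le)).tendsto).const_mul K
    rw [Real.zero_rpow hα.ne', mul_zero] at this
    exact this.mono_left nhdsWithin_le_nhds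
  obtain ⟨t, ⟨ht1, ht2⟩, ht0⟩ := ((hlim.eventually
    (gt_mem_nhds (show (0 : ℝ) < 1 / 2 by norm_num))).and
    (nhdsWithin_le_nhds (eventually_lt_nhds (show 0 < min δ 1 by positivity)))).and
      self_mem_nhdsWithin |>.exists
  have htδ : t < δ := ht2.trans_le (min_le_left _ _)
  refine ⟨K, t, hK, ht0, (ht2.trans_le (min_le_right _ _)).le, ht1.le, fun x hx hxt => ?_⟩
  obtain ⟨ν, hν, hp⟩ := H x hx (hxt.trans htδ)
  exact ⟨ν, hν, fun w hw => hp w (hw.trans htδ)⟩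

theorem IsC1HolderBoundaryIn.hasFracCurvature {n : ℕ} {E U : Set (RSpace n)}
    (hE : NullMeasurableSet E volume) {α : ℝ} (hα : 0 < α) (hα1 : α ≤ 1)
    (hreg : IsC1HolderBoundaryIn E α U) {x : RSpace n} (hx : x ∈ frontier E ∩ U) {s : ℝ}
    (hs : 0 < s) (hsα : s < α) :
    HasFracCurvature s E x (fracCurvature s E x) ∧ Integrable (symKernel s E x) ∧
      fracCurvature s E x = ∫ w, symKernel s E x w := by
  obtain ⟨⟨Φ⟩, K, δ, hK, hδ, -, hKδ, H⟩ := hreg.exists_uniform_isPinched hα hx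
  obtain ⟨ν, hν, hp⟩ := H x hx.1 (by simpa using hδ)
  exact hasFracCurvature_of_integrableOn hE hs hδ
    (integrableOn_symKernel_of_isPinched Φ hE hν hK hα hα1 hp hs hsα hδ le_rfl hKδ).1

/-- Near a boundary point, the truncated curvatures converge to the fractional curvature with a
rate that is uniform in the point. -/
theorem IsC1HolderBoundaryIn.exists_uniform_trunc_bound {n : ℕ} {E U : Set (RSpace n)}
    (hE : NullMeasurableSet E volume) {α : ℝ} (hα : 0 < α) (hα1 : α ≤ 1)
    (hreg : IsC1HolderBoundaryIn E α U) {x₀ : RSpace n} (hx₀ : x₀ ∈ frontier E ∩ U) :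
    ∃ B δ : ℝ, 0 ≤ B ∧ 0 < δ ∧ δ ≤ 1 ∧ ∀ x ∈ frontier E, ‖x - x₀‖ < δ →
      ∀ s η : ℝ, 0 < s → s < α → 0 < η → η ≤ δ →
        |fracCurvature s E x - truncFracCurvature s E x η| ≤ B * (η ^ (α - s) / (α - s)) := by
  obtain ⟨⟨Φ⟩, K, δ, hK, hδ, hδ1, hKδ, H⟩ := hreg.exists_uniform_isPinched hα hx₀
  refine ⟨8 * K * sphereArea (n - 1), δ, mul_nonneg (by positivity) (sphereArea_nonneg _), hδ, hδ1,
    fun x hx hxδ s η hs hsα hη hηδ => ?_⟩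
  obtain ⟨ν, hν, hp⟩ := H x hx hxδ
  have hb := integrableOn_symKernel_of_isPinched Φ hE hν hK hα hα1 hp hs hsα hη hηδ
    (le_trans (by gcongr) hKδ)
  rw [fracCurvature_sub_trunc hE hs hη hb.1]
  exact hb.2.trans (le_of_eq (by ring))

theorem IsC1HolderBoundaryIn.continuousOn_fracCurvature {n : ℕ} {E U : Set (RSpace n)}
    (hE : NullMeasurableSet E volume) {α : ℝ} (hα : 0 < α) (hα1 : α ≤ 1)
    (hreg : IsC1HolderBoundaryIn E α U) :
    ContinuousOn (fun q : ℝ × RSpace n => fracCurvature q.1 E q.2)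
      (Ioo (0 : ℝ) α ×ˢ (frontier E ∩ U)) := by
  rintro ⟨s₀, x₀⟩ ⟨⟨hs₀, hs₀α⟩, hx₀⟩
  obtain ⟨B, δ, hB, hδ, hδ1, H⟩ := hreg.exists_uniform_trunc_bound hE hα hα1 hx₀
  refine continuousWithinAt_of_locally_uniform_approx_of_continuousWithinAt
    ⟨⟨hs₀, hs₀α⟩, hx₀⟩ fun V hV => ?_
  obtain ⟨ε, hε, hεV⟩ := Metric.mem_uniformity_dist.1 hV
  -- for `s ≤ s₁ < α` the rate of convergence is uniform in `s` as well
  set s₁ := (s₀ + α) / 2 with hs₁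
  have h1 : 0 < α - s₁ := by linarith
  have hlim : Tendsto (fun t : ℝ => B * (t ^ (α - s₁) / (α - s₁))) (𝓝[>] 0) (𝓝 0) := by
    have : Tendsto (fun t : ℝ => B * (t ^ (α - s₁) / (α - s₁))) (𝓝 0)
        (𝓝 (B * (0 ^ (α - s₁) / (α - s₁)))) :=
      (((Real.continuousAt_rpow_const 0 (α - s₁) (Or.inr h1.le)).tendsto).div_const _).const_mul B
    rw [Real.zero_rpow h1.ne', zero_div, mul_zero] at this
    exact this.mono_left nhdsWithin_le_nhds
  obtain ⟨η, ⟨hη1, hη2⟩, hη0⟩ := ((hlim.eventually (gt_mem_nhds hε)).and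
    (nhdsWithin_le_nhds (eventually_lt_nhds hδ))).and self_mem_nhdsWithin |>.exists
  have hη0 : 0 < η := hη0
  refine ⟨{q | q.1 < s₁ ∧ ‖q.2 - x₀‖ < δ} ∩ Ioo (0 : ℝ) α ×ˢ (frontier E ∩ U), ?_,
    fun q => truncFracCurvature q.1 E q.2 η,
    (continuousAt_truncFracCurvature hE hs₀ hη0 x₀).continuousWithinAt, ?_⟩
  · refine inter_mem (mem_nhdsWithin_of_mem_nhds ?_) self_mem_nhdsWithin
    refine IsOpen.mem_nhds ?_ ⟨by simp only; linarith, by simpa using hδ⟩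
    exact (isOpen_lt continuous_fst continuous_const).inter
      (isOpen_lt (continuous_snd.sub continuous_const).norm continuous_const)
  · rintro ⟨s, x⟩ ⟨⟨hs1, hxδ⟩, ⟨hs, hsα⟩, hx⟩
    simp only at hs1 hxδ hs hsα hx
    apply hεV
    rw [Real.dist_eq]
    refine (H x hx.1 hxδ s η hs hsα hη0 hη2.le).trans_lt (lt_of_le_of_lt ?_ hη1)
    have : η ^ (α - s) ≤ η ^ (α - s₁) :=
      Real.rpow_le_rpow_of_exponent_ge hη0 (by linarith) (by linarith)
    gcongr

/-! ### The limit `s → 0` -/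

/-- The mean value inequality for a negative power. -/
theorem abs_rpow_neg_sub_rpow_neg_le {a b c p : ℝ} (hc : 0 < c) (hp : 0 ≤ p) (ha : c ≤ a)
    (hb : c ≤ b) : |a ^ (-p) - b ^ (-p)| ≤ p * c ^ (-p - 1) * |a - b| := by
  have := (convex_Ici c).norm_image_sub_le_of_norm_hasDerivWithin_le (f := fun r : ℝ => r ^ (-p))
    (f' := fun r => -p * r ^ (-p - 1)) (C := p * c ^ (-p - 1)) (x := b) (y := a) (fun r hr => ?_)
    (fun r hr => ?_) hb ha
  · simpa using this
  · exact (Real.hasDerivAt_rpow_const (Or.inl (hc.trans_le hr).ne')).hasDerivWithinAt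
  · have hr0 : 0 < r := hc.trans_le hr
    rw [norm_mul, norm_neg, Real.norm_of_nonneg hp, Real.norm_of_nonneg (by positivity)]
    exact mul_le_mul_of_nonneg_left
      (Real.rpow_le_rpow_of_nonpos hc hr (by linarith)) hp

/-- The power kernel centred at `x`, cut off outside the ball of radius `δ`. -/
noncomputable def cutKernel {n : ℕ} (δ s : ℝ) (x y : RSpace n) : ℝ :=
  (Metric.ball x δ)ᶜ.indicator (fun y => ‖y - x‖ ^ (-((n : ℝ) + s))) y

theorem integrable_cutKernel {n : ℕ} {δ s : ℝ} (hδ : 0 < δ) (hs : 0 < s) (x : RSpace n) :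
    Integrable (cutKernel δ s x) ∧
      ∫ y, cutKernel δ s x y = sphereArea n * (δ ^ (-s) / s) := by
  have h := integrableOn_norm_rpow_compl_ball n hs hδ
  have heq : ∀ w, cutKernel δ s x (x + w) =
      (Metric.ball 0 δ)ᶜ.indicator (fun w : RSpace n => ‖w‖ ^ (-((n : ℝ) + s))) w := by
    intro w; simp [cutKernel, indicator]
  constructor
  · rw [← (measurePreserving_add_left volume x).integrable_comp_emb
      (MeasurableEquiv.addLeft x).measurableEmbedding]
    exact ((integrable_indicator_iff measurableSet_ball.compl).2 h.1).congr
      (Eventually.of_forall fun w => (heq w).symm)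
  · rw [← integral_add_left_eq_self _ x, integral_congr_ae (Eventually.of_forall heq),
      integral_indicator measurableSet_ball.compl, h.2]

theorem integrable_indicator_mul_cutKernel {n : ℕ} {E : Set (RSpace n)}
    (hE : NullMeasurableSet E volume) {δ s : ℝ} (hδ : 0 < δ) (hs : 0 < s) (x : RSpace n) :
    Integrable (fun y => E.indicator (fun _ => (1 : ℝ)) y * cutKernel δ s x y) := by
  refine (integrable_cutKernel hδ hs x).1.mono
    ((aestronglyMeasurable_const.indicator₀ hE).mul
      (integrable_cutKernel hδ hs x).1.aestronglyMeasurable) (Eventually.of_forall fun y => ?_)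
  by_cases hy : y ∈ E <;> simp [hy]

theorem truncFracCurvature_eq_cutKernel {n : ℕ} {E : Set (RSpace n)}
    (hE : NullMeasurableSet E volume) {δ s : ℝ} (hδ : 0 < δ) (hs : 0 < s) (x : RSpace n) :
    truncFracCurvature s E x δ = sphereArea n * (δ ^ (-s) / s) -
      2 * ∫ y, E.indicator (fun _ => (1 : ℝ)) y * cutKernel δ s x y := by
  rw [← (integrable_cutKernel hδ hs x).2, ← integral_const_mul,
    ← integral_sub (integrable_cutKernel hδ hs x).1
      ((integrable_indicator_mul_cutKernel hE hδ hs x).const_mul 2), truncFracCurvature,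
    ← integral_indicator measurableSet_ball.compl]
  refine integral_congr_ae (Eventually.of_forall fun y => ?_)
  by_cases hy : y ∈ E <;> by_cases hb : y ∈ Metric.ball x δ
  · simp [cutKernel, hb]
  · simp only [cutKernel, indicator, mem_compl_iff, hb, not_false_eq_true, if_true, hy,
      fracKernel_eq, sideSign_of_mem hy]
    ring
  · simp [cutKernel, hb]
  · simp only [cutKernel, indicator, mem_compl_iff, hb, not_false_eq_true, if_true, hy,
      fracKernel_eq, sideSign_of_notMem hy, if_false]
    ring

/-- Two cut-off kernels differ by an amount that is integrable uniformly down to `s = 0`. -/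
theorem exists_abs_cutKernel_sub_le {n : ℕ} (X : ℝ) {δ : ℝ} (hX : 0 ≤ X) (hδ : 0 < δ)
    (hδ1 : δ ≤ 1) : ∃ D : ℝ, ∀ (x y : RSpace n) (s : ℝ), ‖x‖ ≤ X → 0 < s → s ≤ 1 →
      |cutKernel δ s x y - cutKernel 1 s 0 y| ≤ D * (1 + ‖y‖) ^ (-((n : ℝ) + 1)) := by
  set L := 2 * X + 2 with hL
  refine ⟨max (2 * δ ^ (-((n : ℝ) + 1)) * (1 + L) ^ ((n : ℝ) + 1))
    ((n + 1) * 4 ^ ((n : ℝ) + 2) * X), fun x y s hx hs hs1 => ?_⟩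
  have hn : (0 : ℝ) ≤ n := n.cast_nonneg
  have hy0 := norm_nonneg y
  have hpos : 0 ≤ (1 + ‖y‖) ^ (-((n : ℝ) + 1)) := by positivity
  rcases lt_or_ge ‖y‖ L with hyL | hyL
  · have hδp : 1 ≤ δ ^ (-((n : ℝ) + 1)) :=
      Real.one_le_rpow_of_pos_of_le_one_of_nonpos hδ hδ1 (by linarith)
    have e1 : |cutKernel δ s x y| ≤ δ ^ (-((n : ℝ) + 1)) := by
      rw [cutKernel, indicator]
      split_ifs with h
      · have h' : δ ≤ ‖y - x‖ := by simpa [dist_eq_norm] using h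
        rw [abs_of_nonneg (by positivity)]
        exact (Real.rpow_le_rpow_of_nonpos hδ h' (by linarith)).trans
          (Real.rpow_le_rpow_of_exponent_ge hδ hδ1 (by linarith))
      · rw [abs_zero]; linarith
    have e2 : |cutKernel 1 s 0 y| ≤ 1 := by
      rw [cutKernel, indicator]
      split_ifs with h
      · have h' : 1 ≤ ‖y‖ := by simpa using h
        rw [sub_zero, abs_of_nonneg (by positivity)]
        exact Real.rpow_le_one_of_one_le_of_nonpos h' (by linarith)
      · rw [abs_zero]; linarith
    have e3 : 1 ≤ (1 + L) ^ ((n : ℝ) + 1) * (1 + ‖y‖) ^ (-((n : ℝ) + 1)) := by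
      rw [Real.rpow_neg (by positivity), ← div_eq_mul_inv, one_le_div (by positivity)]
      gcongr
    calc |cutKernel δ s x y - cutKernel 1 s 0 y| ≤ 2 * δ ^ (-((n : ℝ) + 1)) :=
          (abs_sub _ _).trans (by linarith)
      _ ≤ 2 * δ ^ (-((n : ℝ) + 1)) *
          ((1 + L) ^ ((n : ℝ) + 1) * (1 + ‖y‖) ^ (-((n : ℝ) + 1))) :=
          le_mul_of_one_le_right (by positivity) e3
      _ = 2 * δ ^ (-((n : ℝ) + 1)) * (1 + L) ^ ((n : ℝ) + 1) *
          (1 + ‖y‖) ^ (-((n : ℝ) + 1)) := by ring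
      _ ≤ _ := mul_le_mul_of_nonneg_right (le_max_left _ _) hpos
  · have hyx : ‖y‖ - ‖x‖ ≤ ‖y - x‖ := norm_sub_norm_le y x
    -- both centres are at distance at least `(1 + ‖y‖) / 4` from `y`
    have hc : 0 < (1 + ‖y‖) / 4 := by positivity
    have k1 : cutKernel δ s x y = ‖y - x‖ ^ (-((n : ℝ) + s)) := by
      rw [cutKernel, indicator_of_mem]
      simp only [mem_compl_iff, Metric.mem_ball, dist_eq_norm, not_lt]
      linarith
    have k2 : cutKernel 1 s 0 y = ‖y‖ ^ (-((n : ℝ) + s)) := by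
      rw [cutKernel, indicator_of_mem, sub_zero]
      simp only [mem_compl_iff, Metric.mem_ball, dist_zero_right, not_lt]
      linarith
    have hdist : |‖y - x‖ - ‖y‖| ≤ X := by
      refine (abs_norm_sub_norm_le _ _).trans ?_
      simpa using hx
    have h4 : (4 : ℝ) ^ ((n : ℝ) + s + 1) ≤ 4 ^ ((n : ℝ) + 2) :=
      Real.rpow_le_rpow_of_exponent_le (by norm_num) (by linarith)
    rw [k1, k2]
    calc _ ≤ ((n : ℝ) + s) * ((1 + ‖y‖) / 4) ^ (-((n : ℝ) + s) - 1) * |‖y - x‖ - ‖y‖| :=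
          abs_rpow_neg_sub_rpow_neg_le hc (by positivity) (by linarith) (by linarith)
      _ = ((n : ℝ) + s) * (4 ^ ((n : ℝ) + s + 1) * (1 + ‖y‖) ^ (-((n : ℝ) + s + 1))) *
          |‖y - x‖ - ‖y‖| := by
          rw [Real.div_rpow (by positivity) (by norm_num), ← neg_add',
            Real.rpow_neg (by norm_num : (0 : ℝ) ≤ 4), div_inv_eq_mul, mul_comm ((1 + ‖y‖) ^ _)]
      _ ≤ (n + 1) * (4 ^ ((n : ℝ) + 2) * (1 + ‖y‖) ^ (-((n : ℝ) + 1))) * X := by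
          gcongr
          · linarith
          · linarith
      _ = (n + 1) * 4 ^ ((n : ℝ) + 2) * X * (1 + ‖y‖) ^ (-((n : ℝ) + 1)) := by ring
      _ ≤ _ := mul_le_mul_of_nonneg_right (le_max_right _ _) hpos

theorem exists_abs_integral_cutKernel_sub_le {n : ℕ} {E : Set (RSpace n)}
    (hE : NullMeasurableSet E volume) (X : ℝ) {δ : ℝ} (hX : 0 ≤ X) (hδ : 0 < δ) (hδ1 : δ ≤ 1) :
    ∃ D : ℝ, ∀ (x : RSpace n) (s : ℝ), ‖x‖ ≤ X → 0 < s → s ≤ 1 →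
      |(∫ y, E.indicator (fun _ => (1 : ℝ)) y * cutKernel δ s x y) -
        ∫ y, E.indicator (fun _ => (1 : ℝ)) y * cutKernel 1 s 0 y| ≤ D := by
  obtain ⟨D, hD⟩ := exists_abs_cutKernel_sub_le (n := n) X hX hδ hδ1
  have hint : Integrable (fun y : RSpace n => D * (1 + ‖y‖) ^ (-((n : ℝ) + 1))) :=
    (integrable_one_add_norm (by simp)).const_mul D
  refine ⟨∫ y : RSpace n, D * (1 + ‖y‖) ^ (-((n : ℝ) + 1)), fun x s hx hs hs1 => ?_⟩
  rw [← integral_sub (integrable_indicator_mul_cutKernel hE hδ hs x)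
    (integrable_indicator_mul_cutKernel hE one_pos hs 0), ← Real.norm_eq_abs]
  refine norm_integral_le_of_norm_le hint (Eventually.of_forall fun y => ?_)
  refine le_trans ?_ (hD x y s hx hs hs1)
  by_cases hy : y ∈ E <;> simp [hy]

theorem IsC1HolderBoundaryIn.continuousOn_rescaledCurvatureToZero {n : ℕ} {E U : Set (RSpace n)}
    (hE : NullMeasurableSet E volume) {α : ℝ} (hα : 0 < α) (hα1 : α ≤ 1)
    (hreg : IsC1HolderBoundaryIn E α U) {a : ℝ} (ha : HasContributionAtInfinity E a) :
    ContinuousOn (fun q : ℝ × RSpace n => rescaledCurvatureToZero E a q.1 q.2)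
      (Ico (0 : ℝ) α ×ˢ (frontier E ∩ U)) := by
  rintro ⟨s₀, x₀⟩ ⟨⟨hs₀, hs₀α⟩, hx₀⟩
  simp only at hs₀ hs₀α hx₀
  have hunion : Ico (0 : ℝ) α ×ˢ (frontier E ∩ U) =
      ({0} ×ˢ (frontier E ∩ U)) ∪ (Ioo 0 α ×ˢ (frontier E ∩ U)) := by
    rw [← union_prod, singleton_union, Ioo_insert_left hα]
  have heqon : EqOn (fun q : ℝ × RSpace n => rescaledCurvatureToZero E a q.1 q.2)
      (fun q => q.1 * (1 - q.1) * fracCurvature q.1 E q.2) (Ioo 0 α ×ˢ (frontier E ∩ U)) := by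
    rintro ⟨s, x⟩ ⟨⟨hs, -⟩, -⟩
    simp only at hs
    simp [rescaledCurvatureToZero, hs.ne']
  rcases hs₀.eq_or_lt with rfl | hs₀
  · rw [hunion, continuousWithinAt_union]
    constructor
    · refine (continuousWithinAt_const (b := sphereArea n - 2 * a)).congr ?_ ?_
      · rintro ⟨s, x⟩ ⟨hs, -⟩
        simp only [mem_singleton_iff] at hs
        simp [rescaledCurvatureToZero, hs]
      · simp [rescaledCurvatureToZero]
    obtain ⟨B, δ, hB, hδ, hδ1, H⟩ := hreg.exists_uniform_trunc_bound hE hα hα1 hx₀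
    obtain ⟨D, hD⟩ := exists_abs_integral_cutKernel_sub_le hE (‖x₀‖ + 1) (by positivity) hδ hδ1
    set l := 𝓝[Ioo 0 α ×ˢ (frontier E ∩ U)] ((0 : ℝ), x₀) with hl
    have hmem : ∀ᶠ q in l, q ∈ Ioo 0 α ×ˢ (frontier E ∩ U) := self_mem_nhdsWithin
    have hfst : Tendsto (fun q : ℝ × RSpace n => q.1) l (𝓝 0) :=
      (continuous_fst.tendsto ((0 : ℝ), x₀)).mono_left nhdsWithin_le_nhds
    have hfst' : Tendsto (fun q : ℝ × RSpace n => q.1) l (𝓝[>] 0) :=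
      tendsto_nhdsWithin_iff.2 ⟨hfst, hmem.mono fun q hq => hq.1.1⟩
    have hev1 : ∀ᶠ q in l, q.1 < α / 2 := hfst.eventually (gt_mem_nhds (by positivity))
    have hev2 : ∀ᶠ q in l, ‖q.2 - x₀‖ < δ := by
      have : Tendsto (fun q : ℝ × RSpace n => ‖q.2 - x₀‖) l (𝓝 ‖x₀ - x₀‖) :=
        ((continuous_snd.sub continuous_const).norm.tendsto ((0 : ℝ), x₀)).mono_left
          nhdsWithin_le_nhds
      rw [sub_self, norm_zero] at this
      exact this.eventually (gt_mem_nhds hδ)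
    -- the part near the singularity is bounded, hence killed by the factor `s`
    have t1 : Tendsto (fun q : ℝ × RSpace n => q.1 *
        (fracCurvature q.1 E q.2 - truncFracCurvature q.1 E q.2 δ)) l (𝓝 0) := by
      have hb : Tendsto (fun q : ℝ × RSpace n => q.1 * (B * (1 / (α / 2)))) l (𝓝 0) := by
        simpa using hfst.mul_const (B * (1 / (α / 2)))
      refine squeeze_zero_norm' ?_ hb
      filter_upwards [hmem, hev1, hev2] with q hq h1 h2
      have hq1 : 0 < q.1 := hq.1.1
      have hq2 : q.1 < α := hq.1.2
      rw [norm_mul, Real.norm_of_nonneg hq1.le, Real.norm_eq_abs]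
      refine mul_le_mul_of_nonneg_left ?_ hq1.le
      refine (H q.2 hq.2.1 h2 q.1 δ hq1 hq2 hδ le_rfl).trans ?_
      have : δ ^ (α - q.1) ≤ 1 := Real.rpow_le_one hδ.le hδ1 (by linarith)
      gcongr
      linarith
    have t2 : Tendsto (fun q : ℝ × RSpace n => q.1 *
        ((∫ y, E.indicator (fun _ => (1 : ℝ)) y * cutKernel δ q.1 q.2 y) -
          ∫ y, E.indicator (fun _ => (1 : ℝ)) y * cutKernel 1 q.1 0 y)) l (𝓝 0) := by
      have hb : Tendsto (fun q : ℝ × RSpace n => q.1 * D) l (𝓝 0) := by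
        simpa using hfst.mul_const D
      refine squeeze_zero_norm' ?_ hb
      filter_upwards [hmem, hev1, hev2] with q hq h1 h2
      have hq1 : 0 < q.1 := hq.1.1
      rw [norm_mul, Real.norm_of_nonneg hq1.le, Real.norm_eq_abs]
      refine mul_le_mul_of_nonneg_left (hD q.2 q.1 ?_ hq1 (by linarith)) hq1.le
      linarith [norm_le_norm_add_norm_sub x₀ q.2, norm_sub_rev q.2 x₀]
    have t3 : Tendsto (fun q : ℝ × RSpace n => q.1 *
        ∫ y, E.indicator (fun _ => (1 : ℝ)) y * cutKernel 1 q.1 0 y) l (𝓝 a) := by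
      refine (ha.comp hfst').congr fun q => ?_
      simp only [Function.comp_apply]
      rw [← integral_indicator measurableSet_ball.compl]
      congr 1
      refine integral_congr_ae (Eventually.of_forall fun y => ?_)
      by_cases hb : y ∈ Metric.ball (0 : RSpace n) 1
      · simp [cutKernel, hb]
      · simp only [cutKernel, indicator, mem_compl_iff, hb, not_false_eq_true, if_true, sub_zero]
        rw [Real.rpow_neg (norm_nonneg _), div_eq_mul_inv]
    have t4 : Tendsto (fun q : ℝ × RSpace n => sphereArea n * δ ^ (-q.1)) l (𝓝 (sphereArea n)) := by
      have : Tendsto (fun q : ℝ × RSpace n => sphereArea n * δ ^ (-q.1)) l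
          (𝓝 (sphereArea n * δ ^ (-(0 : ℝ)))) :=
        (tendsto_const_nhds.rpow hfst.neg (Or.inl hδ.ne')).const_mul _
      simpa using this
    have t5 : Tendsto (fun q : ℝ × RSpace n => 1 - q.1) l (𝓝 1) := by
      simpa using hfst.const_sub 1
    have total := t5.mul (t1.add ((t4.sub (t2.const_mul 2)).sub (t3.const_mul 2)))
    rw [ContinuousWithinAt, show rescaledCurvatureToZero E a 0 x₀ =
      1 * (0 + (sphereArea n - 2 * 0 - 2 * a)) by simp [rescaledCurvatureToZero]]
    refine total.congr' ?_
    filter_upwards [hmem] with q hq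
    have hq1 : 0 < q.1 := hq.1.1
    have hF := heqon hq
    simp only at hF
    rw [hF, truncFracCurvature_eq_cutKernel hE hδ hq1]
    field_simp
    ring
  · have hcont := (hreg.continuousOn_fracCurvature hE hα hα1) (s₀, x₀) ⟨⟨hs₀, hs₀α⟩, hx₀⟩
    have h1 : ContinuousWithinAt (fun q : ℝ × RSpace n =>
        q.1 * (1 - q.1) * fracCurvature q.1 E q.2) (Ioo 0 α ×ˢ (frontier E ∩ U)) (s₀, x₀) :=
      (Continuous.continuousWithinAt (by fun_prop)).mul hcont
    have h2 := h1.congr heqon (heqon ⟨⟨hs₀, hs₀α⟩, hx₀⟩)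
    refine h2.mono_of_mem_nhdsWithin ?_
    rw [mem_nhdsWithin]
    refine ⟨Ioi 0 ×ˢ univ, isOpen_Ioi.prod isOpen_univ, ⟨hs₀, mem_univ _⟩, ?_⟩
    rintro ⟨s, x⟩ ⟨⟨h1, -⟩, ⟨-, h3⟩, h4⟩
    exact ⟨⟨h1, h3⟩, h4⟩

/-! ### Averages of quadratic forms -/

theorem abs_coord_mul_coord_le {m : ℕ} (y : RSpace m) (i j : Fin m) : |y i * y j| ≤ ‖y‖ ^ 2 := by
  rw [abs_mul, sq]
  exact mul_le_mul (PiLp.norm_apply_le y i) (PiLp.norm_apply_le y j) (abs_nonneg _) (norm_nonneg _)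

theorem integrable_coord_mul_coord {m : ℕ} {f : ℝ → ℝ} (hfm : Measurable f)
    (hf : Integrable (fun y : RSpace m => ‖y‖ ^ 2 * f ‖y‖)) (i j : Fin m) :
    Integrable (fun y : RSpace m => y i * y j * f ‖y‖) := by
  refine hf.mono ?_ (Eventually.of_forall fun y => ?_)
  · have hi : Measurable fun y : RSpace m => y i := by fun_prop
    have hj : Measurable fun y : RSpace m => y j := by fun_prop
    exact ((hi.mul hj).mul (hfm.comp measurable_norm)).aestronglyMeasurable
  · rw [norm_mul, norm_mul (‖y‖ ^ 2), Real.norm_of_nonneg (sq_nonneg ‖y‖)]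
    exact mul_le_mul_of_nonneg_right (abs_coord_mul_coord_le y i j) (norm_nonneg _)

/-- The integrand is odd in the `i`-th coordinate. -/
theorem integral_coord_mul_coord_of_ne {m : ℕ} (f : ℝ → ℝ) {i j : Fin m} (hij : i ≠ j) :
    ∫ y : RSpace m, y i * y j * f ‖y‖ = 0 := by
  let T : RSpace m ≃ₗᵢ[ℝ] RSpace m := LinearIsometryEquiv.piLpCongrRight 2
    (fun k => if k = i then LinearIsometryEquiv.neg ℝ else LinearIsometryEquiv.refl ℝ ℝ)
  have h := T.measurePreserving.integral_comp T.toMeasurableEquiv.measurableEmbedding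
    (fun y : RSpace m => y i * y j * f ‖y‖)
  have h2 : ∀ y : RSpace m, (T y) i * (T y) j * f ‖T y‖ = -(y i * y j * f ‖y‖) := by
    intro y
    have hi : (T y) i = - y i := by simp [T]
    have hj : (T y) j = y j := by simp [T, hij.symm]
    rw [hi, hj, T.norm_map]; ring
  simp_rw [h2] at h
  rw [integral_neg] at h
  linarith

theorem integral_coord_sq_eq {m : ℕ} (f : ℝ → ℝ) (i j : Fin m) :
    ∫ y : RSpace m, y i * y i * f ‖y‖ = ∫ y : RSpace m, y j * y j * f ‖y‖ := by
  let T : RSpace m ≃ₗᵢ[ℝ] RSpace m := LinearIsometryEquiv.piLpCongrLeft 2 ℝ ℝ (Equiv.swap i j)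
  have h := T.measurePreserving.integral_comp T.toMeasurableEquiv.measurableEmbedding
    (fun y : RSpace m => y i * y i * f ‖y‖)
  rw [← h]
  refine integral_congr_ae (Eventually.of_forall fun y => ?_)
  have hi : (T y) i = y j := by simp [T, LinearIsometryEquiv.piLpCongrLeft_apply]
  simp only [hi, T.norm_map]

/-- By rotational symmetry, a quadratic form integrates against a radial weight like its trace
divided by the dimension times `|y|²`. -/
theorem integral_quadratic_mul_radial {m : ℕ} (a : Fin m → Fin m → ℝ) {f : ℝ → ℝ}
    (hfm : Measurable f) (hf : Integrable (fun y : RSpace m => ‖y‖ ^ 2 * f ‖y‖)) :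
    ∫ y : RSpace m, (∑ i, ∑ j, a i j * (y i * y j)) * f ‖y‖ =
      (∑ i, a i i) / m * ∫ y : RSpace m, ‖y‖ ^ 2 * f ‖y‖ := by
  have h1 : ∀ y : RSpace m, (∑ i, ∑ j, a i j * (y i * y j)) * f ‖y‖ =
      ∑ i, ∑ j, a i j * (y i * y j * f ‖y‖) := by
    intro y
    simp_rw [Finset.sum_mul, mul_assoc]
  have hint := integrable_coord_mul_coord hfm hf
  have h2 : ∀ i, ∫ y : RSpace m, y i * y i * f ‖y‖ =
      (∫ y : RSpace m, ‖y‖ ^ 2 * f ‖y‖) / m := by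
    intro i
    have hm : (m : ℝ) ≠ 0 := by exact_mod_cast (Fin.pos i).ne'
    have hsum : ∀ y : RSpace m, ‖y‖ ^ 2 * f ‖y‖ = ∑ j, y j * y j * f ‖y‖ := by
      intro y
      rw [EuclideanSpace.real_norm_sq_eq, Finset.sum_mul]
      simp_rw [sq]
    simp_rw [hsum]
    rw [integral_finsetSum _ fun j _ => hint j j,
      Finset.sum_congr rfl fun j _ => integral_coord_sq_eq f j i]
    simp [hm]
  simp_rw [h1]
  rw [integral_finsetSum _ fun i _ => integrable_finsetSum _ fun j _ => (hint i j).const_mul _]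
  rw [Finset.sum_div, Finset.sum_mul]
  refine Finset.sum_congr rfl fun i _ => ?_
  rw [integral_finsetSum _ fun j _ => (hint i j).const_mul _, Finset.sum_eq_single i]
  · rw [integral_const_mul, h2]; ring
  · intro j _ hji
    rw [integral_const_mul, integral_coord_mul_coord_of_ne f hji.symm, mul_zero]
  · simp

/-! ### Restriction of an operator to a hyperplane -/

/-- The inclusion of the horizontal hyperplane of the coordinates `Φ`. -/
noncomputable def OrthoCoords.lift {n : ℕ} (Φ : OrthoCoords n) : RSpace (n - 1) →L[ℝ] RSpace n :=
  (Φ.symm.toContinuousLinearEquiv : WithLp 2 (RSpace (n - 1) × ℝ) →L[ℝ] RSpace n) ∘L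
    ((WithLp.prodContinuousLinearEquiv 2 ℝ (RSpace (n - 1)) ℝ).symm :
      RSpace (n - 1) × ℝ →L[ℝ] WithLp 2 (RSpace (n - 1) × ℝ)) ∘L
      ContinuousLinearMap.inl ℝ (RSpace (n - 1)) ℝ

theorem OrthoCoords.lift_apply {n : ℕ} (Φ : OrthoCoords n) (y : RSpace (n - 1)) :
    Φ.lift y = Φ.symm (WithLp.toLp 2 (y, 0)) := rfl

theorem OrthoCoords.norm_lift {n : ℕ} (Φ : OrthoCoords n) (y : RSpace (n - 1)) :
    ‖Φ.lift y‖ = ‖y‖ := by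
  rw [Φ.lift_apply, Φ.symm.norm_map, WithLp.prod_norm_eq_of_L2]
  simp

theorem OrthoCoords.inner_lift {n : ℕ} (Φ : OrthoCoords n) (y : RSpace (n - 1)) (w : RSpace n) :
    inner ℝ (Φ.lift y) w = inner ℝ y (Φ w).fst := by
  rw [Φ.lift_apply, ← Φ.inner_map_map, Φ.apply_symm_apply, WithLp.prod_inner_apply]
  simp

theorem OrthoCoords.norm_sub_lift {n : ℕ} (Φ : OrthoCoords n) (w : RSpace n) :
    ‖w - Φ.lift (Φ w).fst‖ = |(Φ w).snd| := by
  rw [← Φ.norm_map, map_sub, Φ.lift_apply, Φ.apply_symm_apply, WithLp.prod_norm_eq_of_L2]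
  simp [Real.sqrt_sq_eq_abs]

/-- The trace of an operator is the trace of its compression to a hyperplane plus its value on the
unit normal. -/
theorem OrthoCoords.sum_inner_lift {n : ℕ} {Ψ : OrthoCoords n} {ν : RSpace n}
    (h : Ψ ν = WithLp.toLp 2 (0, 1)) (A : RSpace n →L[ℝ] RSpace n) :
    ∑ i, inner ℝ (A (Ψ.lift (EuclideanSpace.single i 1))) (Ψ.lift (EuclideanSpace.single i 1)) =
      LinearMap.trace ℝ (RSpace n) (A : RSpace n →ₗ[ℝ] RSpace n) - inner ℝ (A ν) ν := by
  have hν : ν = Ψ.symm (WithLp.toLp 2 (0, 1)) := by rw [← h, Ψ.symm_apply_apply]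
  have key := LinearMap.trace_eq_sum_inner (A : RSpace n →ₗ[ℝ] RSpace n)
    (((EuclideanSpace.basisFun (Fin (n - 1)) ℝ).prod
      (OrthonormalBasis.singleton Unit ℝ)).map Ψ.symm)
  rw [key, Fintype.sum_sum_type]
  simp only [OrthonormalBasis.map_apply, OrthonormalBasis.prod_apply, Sum.elim_inl, Sum.elim_inr,
    Function.comp_apply, EuclideanSpace.basisFun_apply, Finset.univ_unique, Finset.sum_singleton,
    OrthonormalBasis.singleton_apply, LinearMap.inl_apply, LinearMap.inr_apply,
    ContinuousLinearMap.coe_coe, hν, Ψ.lift_apply, real_inner_comm]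
  simp

theorem OrthoCoords.inner_lift_eq_sum {n : ℕ} (Ψ : OrthoCoords n) (A : RSpace n →L[ℝ] RSpace n)
    (y : RSpace (n - 1)) :
    inner ℝ (A (Ψ.lift y)) (Ψ.lift y) =
      ∑ i, ∑ j, inner ℝ (A (Ψ.lift (EuclideanSpace.single i 1)))
        (Ψ.lift (EuclideanSpace.single j 1)) * (y i * y j) := by
  have hy : y = ∑ i, y i • EuclideanSpace.single i (1 : ℝ) := by
    have := (EuclideanSpace.basisFun (Fin (n - 1)) ℝ).sum_repr y
    simpa using this.symm
  conv_lhs => rw [hy]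
  simp_rw [map_sum, map_smul, sum_inner, inner_sum, inner_smul_left, inner_smul_right]
  refine Finset.sum_congr rfl fun i _ => Finset.sum_congr rfl fun j _ => ?_
  simp only [conj_trivial]
  ring

theorem OrthoCoords.abs_quadratic_sub_le {n : ℕ} (Ψ : OrthoCoords n) {A : RSpace n →L[ℝ] RSpace n}
    {K : ℝ} (hA : ‖A‖ ≤ K) (w : RSpace n) :
    |inner ℝ (A w) w - inner ℝ (A (Ψ.lift (Ψ w).fst)) (Ψ.lift (Ψ w).fst)| ≤
      2 * K * |(Ψ w).snd| * ‖w‖ := by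
  set y := Ψ.lift (Ψ w).fst with hy
  have hyw : ‖y‖ ≤ ‖w‖ := by rw [hy, Ψ.norm_lift]; exact Ψ.norm_fst_le w
  have hK : 0 ≤ K := (norm_nonneg A).trans hA
  have h1 : inner ℝ (A w) w - inner ℝ (A y) y =
      inner ℝ (A (w - y)) w + inner ℝ (A y) (w - y) := by
    rw [map_sub, inner_sub_left, inner_sub_right]; ring
  have h2 : ‖w - y‖ = |(Ψ w).snd| := Ψ.norm_sub_lift w
  have hAl : ∀ v, ‖A v‖ ≤ K * ‖v‖ := fun v => A.le_of_opNorm_le hA v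
  rw [h1]
  calc _ ≤ |inner ℝ (A (w - y)) w| + |inner ℝ (A y) (w - y)| := abs_add_le _ _
    _ ≤ ‖A (w - y)‖ * ‖w‖ + ‖A y‖ * ‖w - y‖ :=
        add_le_add (abs_real_inner_le_norm _ _) (abs_real_inner_le_norm _ _)
    _ ≤ (K * ‖w - y‖) * ‖w‖ + (K * ‖w‖) * ‖w - y‖ := by
        gcongr
        · exact hAl _
        · exact (hAl _).trans (by gcongr)
    _ = _ := by rw [h2]; ring

theorem abs_inner_map_self_le {n : ℕ} {A : RSpace n →L[ℝ] RSpace n} {K : ℝ} (hA : ‖A‖ ≤ K)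
    (v : RSpace n) : |inner ℝ (A v) v| ≤ K * ‖v‖ ^ 2 := by
  calc _ ≤ ‖A v‖ * ‖v‖ := abs_real_inner_le_norm _ _
    _ ≤ (K * ‖v‖) * ‖v‖ := by gcongr; exact A.le_of_opNorm_le hA v
    _ = _ := by ring

/-! ### The quadratic model -/

/-- The even part of the sign of `q(y) - t` weighted by `|y|^{-(m+1+s)}`, for `|y| < δ`: it is the
sign of `q(y)` when `|t| < |q(y)|`, and zero otherwise. -/
noncomputable def modelWeight {m : ℕ} (q : RSpace m → ℝ) (s δ : ℝ) (z : RSpace m × ℝ) : ℝ :=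
  {z : RSpace m × ℝ | ‖z.1‖ < δ ∧ |z.2| < |q z.1|}.indicator
    (fun z => q z.1 / |q z.1| * ‖z.1‖ ^ (-((m : ℝ) + 1 + s))) z

theorem measurable_modelWeight {m : ℕ} {q : RSpace m → ℝ} (hq : Measurable q) (s δ : ℝ) :
    Measurable (modelWeight q s δ) := by
  have hq1 : Measurable fun z : RSpace m × ℝ => q z.1 := hq.comp measurable_fst
  refine Measurable.indicator ((hq1.div hq1.abs).mul (measurable_fst.norm.pow_const _)) ?_
  exact (measurableSet_lt measurable_fst.norm measurable_const).inter
    (measurableSet_lt measurable_snd.abs hq1.abs)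

theorem abs_div_abs_self_le (a : ℝ) : abs (a / |a|) ≤ 1 := by
  rw [abs_div, abs_abs]; exact div_self_le_one _

theorem abs_modelWeight_le {m : ℕ} {q : RSpace m → ℝ} {K : ℝ} (hq : ∀ y, |q y| ≤ K * ‖y‖ ^ 2)
    (s δ : ℝ) (z : RSpace m × ℝ) :
    |modelWeight q s δ z| ≤ slabWeight (fun _ => 0) K 1 s δ z := by
  rw [modelWeight, indicator]
  split_ifs with h
  · obtain ⟨y, t⟩ := z
    simp only [mem_ofPred_eq] at h
    rw [slabWeight_of_mem h.1]
    · rw [abs_mul, abs_of_nonneg (Real.rpow_nonneg (norm_nonneg y) _)]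
      exact mul_le_of_le_one_left (by positivity) (abs_div_abs_self_le _)
    · rw [sub_zero, one_add_one_eq_two, Real.rpow_two]
      exact h.2.le.trans (hq y)
  · rw [abs_zero]; exact slabWeight_nonneg _ _ _ _ _ _

theorem modelWeight_fiber {m : ℕ} (q : RSpace m → ℝ) (s δ : ℝ) (y : RSpace m) :
    ∫ t, modelWeight q s δ (y, t) =
      (Metric.ball 0 δ).indicator (fun y => 2 * q y * ‖y‖ ^ (-((m : ℝ) + 1 + s))) y := by
  have h : (fun t => modelWeight q s δ (y, t)) = (Ioo (-|q y|) |q y|).indicator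
      (fun _ => (Metric.ball 0 δ).indicator
        (fun y => q y / |q y| * ‖y‖ ^ (-((m : ℝ) + 1 + s))) y) := by
    ext t
    simp only [modelWeight, indicator, mem_ofPred_eq, mem_Ioo, Metric.mem_ball, dist_zero_right,
      abs_lt]
    by_cases h1 : ‖y‖ < δ <;> simp [h1]
  rw [h, integral_indicator measurableSet_Ioo, setIntegral_const, smul_eq_mul,
    Real.volume_real_Ioo_of_le (by linarith [abs_nonneg (q y)])]
  simp only [indicator]
  split_ifs with h1
  · rcases eq_or_ne (q y) 0 with h0 | h0
    · simp [h0]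
    · have := abs_pos.2 h0
      field_simp
      ring
  · simp

/-- The fibre of the model over `y` has integral `2 q(y) |y|^{-(m+1+s)}`, whose average only sees
the trace of `q`. -/
theorem integral_modelWeight {m : ℕ} {a : Fin m → Fin m → ℝ} {q : RSpace m → ℝ}
    (hqa : ∀ y, q y = ∑ i, ∑ j, a i j * (y i * y j)) {K : ℝ} (hK : 0 ≤ K)
    (hq : ∀ y, |q y| ≤ K * ‖y‖ ^ 2) {s δ : ℝ} (hs : 0 < s) (hs1 : s < 1)
    (hδ : 0 < δ) :
    Integrable (modelWeight q s δ) ∧ ∫ z, modelWeight q s δ z =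
      2 * ((∑ i, a i i) / m) * (sphereArea m * (δ ^ (1 - s) / (1 - s))) := by
  have hqm : Measurable q := by
    have : q = fun y => ∑ i, ∑ j, a i j * (y i * y j) := funext hqa
    rw [this]; fun_prop
  have hint : Integrable (modelWeight q s δ) :=
    (integrable_slabWeight measurable_const hK (by norm_num) hs1 hδ).1.mono'
      (measurable_modelWeight hqm s δ).aestronglyMeasurable
      (Eventually.of_forall fun z => abs_modelWeight_le hq s δ z)
  refine ⟨hint, ?_⟩
  set f : ℝ → ℝ := (Iio δ).indicator fun r => r ^ (-((m : ℝ) + 1 + s)) with hf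
  have hfm : Measurable f := (measurable_id.pow_const _).indicator measurableSet_Iio
  have hf2 : ∀ y : RSpace m, ‖y‖ ^ 2 * f ‖y‖ =
      (Metric.ball 0 δ).indicator (fun y => ‖y‖ ^ ((1 - s) - m)) y := by
    intro y
    simp only [hf, indicator, mem_Iio, Metric.mem_ball, dist_zero_right]
    split_ifs with h
    · rcases eq_or_ne y 0 with rfl | hy
      · have : 1 - s - (m : ℝ) ≠ 0 := by
          rcases Nat.eq_zero_or_pos m with rfl | hm
          · have : 1 - s ≠ 0 := by linarith
            simpa using this
          · have : (1 : ℝ) ≤ m := by exact_mod_cast hm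
            intro h
            linarith
        rw [norm_zero, Real.zero_rpow this]; simp
      · rw [← Real.rpow_two, ← Real.rpow_add (norm_pos_iff.2 hy)]
        congr 1; ring
    · simp
  have hball := integrableOn_norm_rpow_ball m (sub_pos.2 hs1) hδ
  rw [← integrable_indicator_iff measurableSet_ball] at hball
  have key := integral_quadratic_mul_radial a hfm (hball.congr (Eventually.of_forall fun y =>
    (hf2 y).symm))
  rw [integral_congr_ae (Eventually.of_forall hf2), integral_indicator measurableSet_ball,
    integral_norm_rpow_ball m (sub_pos.2 hs1) hδ] at key
  rw [Measure.volume_eq_prod] at hint ⊢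
  rw [integral_prod _ hint, mul_assoc, ← key, ← integral_const_mul]
  refine integral_congr_ae (Eventually.of_forall fun y => ?_)
  simp only [modelWeight_fiber, ← hqa]
  simp only [hf, indicator, mem_Iio, Metric.mem_ball, dist_zero_right]
  split_ifs <;> ring

/-! ### Comparison with the quadratic model -/

/-- A point above the graph of the horizontal part of a quadratic form, by a margin, is above the
full paraboloid: the vertical variable contributes either a small multiple of `|y|²` or a small
multiple of itself. -/
theorem paraboloid_lt_of_lt {K ε δ q Q y t ω : ℝ} (hK : 0 ≤ K) (hε : 0 ≤ ε) (hε1 : ε ≤ 1)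
    (hδε : δ ≤ ε) (hδ : (2 * K + 2) * δ ≤ 1 / 8) (hq : |q| ≤ K * y ^ 2)
    (hQ : |Q - q| ≤ 2 * K * |t| * ω) (hω : ω ^ 2 = y ^ 2 + t ^ 2) (hω0 : 0 ≤ ω) (hωδ : ω ≤ 2 * δ)
    (ht : q + (4 * K * (2 * K + 2) + 2) * ε * y ^ 2 < t) : Q + ε * ω ^ 2 < t := by
  have hδ0 : 0 ≤ δ := by linarith
  have hQ' := (abs_le.1 hQ).2
  have hq' := abs_le.1 hq
  have htω : |t| ≤ ω := abs_le_of_sq_le_sq (by nlinarith [sq_nonneg y]) hω0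
  have ht0 := abs_nonneg t
  have hyy := sq_nonneg y
  have hyω : |y| ≤ ω := abs_le_of_sq_le_sq (by nlinarith [sq_nonneg t]) hω0
  set L := 2 * K + 2 with hL
  have hL0 : 0 < L := by positivity
  rcases le_or_gt |t| (L * y ^ 2) with hc | hc
  · have e1 : 2 * K * |t| * ω ≤ 2 * K * (L * y ^ 2) * (2 * ε) := by
      gcongr; linarith
    have e2 : t ^ 2 ≤ y ^ 2 := by
      have : |t| ≤ |y| := by
        calc |t| ≤ L * y ^ 2 := hc
          _ = L * |y| * |y| := by rw [mul_assoc, ← sq, sq_abs]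
          _ ≤ 1 * |y| := by
              gcongr
              calc L * |y| ≤ L * (2 * δ) := by gcongr; linarith
                _ ≤ 1 := by linarith
          _ = |y| := one_mul _
      exact sq_le_sq.2 this
    have e3 : ε * ω ^ 2 ≤ ε * (2 * y ^ 2) := by rw [hω]; gcongr; linarith
    nlinarith
  · have htpos : 0 < t := by
      by_contra hneg
      have : |t| = -t := abs_of_nonpos (not_lt.1 hneg)
      have h1 : 0 ≤ (4 * K * L + 2) * ε * y ^ 2 := by positivity
      nlinarith
    rw [abs_of_pos htpos] at *
    have e1 : 2 * K * t * ω ≤ 2 * K * t * (2 * δ) := by gcongr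
    have e2 : ε * ω ^ 2 ≤ ε * y ^ 2 + t * (2 * δ) := by
      rw [hω]
      have : ε * t ^ 2 ≤ 1 * (t * (2 * δ)) := by
        gcongr
        rw [sq]; gcongr; linarith
      linarith
    have e3 : ε * y ^ 2 ≤ y ^ 2 := mul_le_of_le_one_left hyy hε1
    have e4 : t * (L * δ) ≤ t * (1 / 8) := by gcongr
    nlinarith

/-- Raising a point of the hyperplane to the height of a paraboloid changes the kernel by a small
relative amount. -/
theorem rpow_neg_sub_le_of_le_add_sq {K δ p ω y : ℝ} {n : ℕ} (hK : 0 ≤ K) (hKδ : K * δ ≤ 1)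
    (hy : 0 < y) (hyδ : y < δ) (hyω : y ≤ ω) (hω : ω ≤ y + K * y ^ 2) (hp : 0 ≤ p) (hpn : p ≤ n) :
    0 ≤ y ^ (-p) - ω ^ (-p) ∧ y ^ (-p) - ω ^ (-p) ≤ n * (K * δ) * y ^ (-p) := by
  have hω0 : 0 < ω := hy.trans_le hyω
  constructor
  · have := Real.rpow_le_rpow_of_nonpos hy hyω (by linarith : -p ≤ 0)
    linarith
  · have h1 : 1 - K * δ ≤ y / ω := by
      rw [le_div_iff₀ hω0]
      have h2 : ω ≤ y * (1 + K * δ) := by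
        nlinarith [mul_nonneg hK (mul_nonneg hy.le (sub_nonneg.2 hyδ.le))]
      have h3 : (1 - K * δ) * ω ≤ (1 - K * δ) * (y * (1 + K * δ)) :=
        mul_le_mul_of_nonneg_left h2 (by linarith)
      nlinarith [mul_nonneg hy.le (sq_nonneg (K * δ))]
    have h2 : 1 - n * (K * δ) ≤ (y / ω) ^ p := by
      calc 1 - n * (K * δ) = 1 + n * (-(K * δ)) := by ring
        _ ≤ (1 + -(K * δ)) ^ n := one_add_mul_le_pow (by linarith) n
        _ ≤ (y / ω) ^ n := by
            refine pow_le_pow_left₀ (by linarith) (by linarith) n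
        _ = (y / ω) ^ (n : ℝ) := (Real.rpow_natCast _ _).symm
        _ ≤ _ := Real.rpow_le_rpow_of_exponent_ge (by positivity)
            ((div_le_one hω0).2 hyω) hpn
    have h3 : ω ^ (-p) = (y / ω) ^ p * y ^ (-p) := by
      rw [Real.div_rpow hy.le hω0.le, Real.rpow_neg hω0.le, Real.rpow_neg hy.le]
      have := (Real.rpow_pos_of_pos hy p).ne'
      field_simp
    have h4 : 0 ≤ y ^ (-p) := by positivity
    rw [h3]
    nlinarith

/-- On a cylinder, a set pinched along a paraboloid has the same even part as the quadratic model,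
up to thin slabs around `± q` and up to the variation of the kernel in the vertical variable. -/
theorem abs_symKernel_sub_modelWeight_le {n : ℕ} {E : Set (RSpace n)} {Ψ : OrthoCoords n}
    {x ν : RSpace n} (hΨ : Ψ ν = WithLp.toLp 2 (0, 1)) {A : RSpace n →L[ℝ] RSpace n}
    {K ε δ s : ℝ} (hA : ‖A‖ ≤ K) (hε1 : ε ≤ 1) (hδ : 0 < δ) (hδε : δ ≤ ε)
    (hδK : (2 * K + 2) * δ ≤ 1 / 8) (hs : 0 < s) (hs1 : s < 1)
    (hpin : IsPinched E x ν (fun w => inner ℝ (A w) w) (fun w => ε * ‖w‖ ^ 2) (2 * δ))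
    (w : RSpace n) :
    |{w : RSpace n | ‖(Ψ w).fst‖ < δ ∧ |(Ψ w).snd| < δ}.indicator (symKernel s E x) w -
        modelWeight (fun y => inner ℝ (A (Ψ.lift y)) (Ψ.lift y)) s δ ((Ψ w).fst, (Ψ w).snd)| ≤
      2 * (slabWeight (fun y => inner ℝ (A (Ψ.lift y)) (Ψ.lift y))
            ((4 * K * (2 * K + 2) + 2) * ε) 1 s δ ((Ψ w).fst, (Ψ w).snd) +
          slabWeight (fun y => -inner ℝ (A (Ψ.lift y)) (Ψ.lift y))
            ((4 * K * (2 * K + 2) + 2) * ε) 1 s δ ((Ψ w).fst, (Ψ w).snd)) +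
        (n + 1) * (K * δ) * slabWeight (fun _ => 0) K 1 s δ ((Ψ w).fst, (Ψ w).snd) := by
  have hK : 0 ≤ K := (norm_nonneg A).trans hA
  have hε : 0 < ε := hδ.trans_le hδε
  set q : RSpace (n - 1) → ℝ := fun y => inner ℝ (A (Ψ.lift y)) (Ψ.lift y) with hq
  set κ := (4 * K * (2 * K + 2) + 2) * ε with hκ
  have hκ0 : 0 ≤ κ := by positivity
  have hKδ : K * δ ≤ 1 := by nlinarith
  have hqK : ∀ y, |q y| ≤ K * ‖y‖ ^ 2 := fun y => by
    have := abs_inner_map_self_le hA (Ψ.lift y)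
    rwa [Ψ.norm_lift] at this
  have hsq := Ψ.norm_sq_eq w
  have hyw := Ψ.norm_fst_le w
  have htw := Ψ.abs_snd_le w
  have hwyt := Ψ.norm_le_add w
  have hin := OrthoCoords.snd_eq_inner hΨ w
  have hQ := Ψ.abs_quadratic_sub_le hA w
  change |inner ℝ (A w) w - q (Ψ w).fst| ≤ _ at hQ
  have hqy := hqK (Ψ w).fst
  set y := (Ψ w).fst with hy
  set t := (Ψ w).snd with ht
  have hn0 : (0 : ℝ) ≤ n := n.cast_nonneg
  have hp : ((n - 1 : ℕ) : ℝ) + 1 + s = n + s := by rw [Ψ.cast_pred_add_one]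
  have hs1' : 0 ≤ slabWeight q κ 1 s δ (y, t) := slabWeight_nonneg _ _ _ _ _ _
  have hs2' : 0 ≤ slabWeight (fun y => -q y) κ 1 s δ (y, t) := slabWeight_nonneg _ _ _ _ _ _
  have hs3' : 0 ≤ (n + 1) * (K * δ) * slabWeight (fun _ => 0) K 1 s δ (y, t) :=
    mul_nonneg (by positivity) (slabWeight_nonneg _ _ _ _ _ _)
  by_cases hyδ : ‖y‖ < δ
  swap
  · have h1 : {w : RSpace n | ‖(Ψ w).fst‖ < δ ∧ |(Ψ w).snd| < δ}.indicator
        (symKernel s E x) w = 0 :=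
      indicator_of_notMem (fun h => hyδ h.1) _
    have h2 : modelWeight q s δ (y, t) = 0 := indicator_of_notMem (fun h => hyδ h.1) _
    rw [h1, h2, sub_zero, abs_zero]
    positivity
  have hpow : ‖y‖ ^ ((1 : ℝ) + 1) = ‖y‖ ^ 2 := by rw [one_add_one_eq_two, Real.rpow_two]
  -- the slabs around the graphs of `q` and `-q` account for `x + w` and `x - w` respectively
  by_cases hslab : |t - q y| ≤ κ * ‖y‖ ^ 2 ∨ |t - -q y| ≤ κ * ‖y‖ ^ 2
  · -- inside the slabs both terms are at most `|y|^{-(n+s)}`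
    have hsum : ‖y‖ ^ (-((n : ℝ) + s)) ≤
        slabWeight q κ 1 s δ (y, t) + slabWeight (fun y => -q y) κ 1 s δ (y, t) := by
      rcases hslab with h | h
      · rw [slabWeight_of_mem (c := q) hyδ (by rwa [hpow]), hp]; linarith
      · rw [slabWeight_of_mem (c := fun y => -q y) hyδ (by rwa [hpow]), hp]; linarith
    have hm : |modelWeight q s δ (y, t)| ≤ ‖y‖ ^ (-((n : ℝ) + s)) := by
      rw [modelWeight, indicator]
      split_ifs
      · rw [hp, abs_mul, abs_of_nonneg (Real.rpow_nonneg (norm_nonneg y) _)]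
        exact mul_le_of_le_one_left (by positivity) (abs_div_abs_self_le _)
      · rw [abs_zero]; positivity
    have hk : |symKernel s E x w| ≤ ‖y‖ ^ (-((n : ℝ) + s)) := by
      rcases eq_or_ne y 0 with h0 | h0
      · have hq0 : q y = 0 := by
          have : |q y| ≤ 0 := by simpa [h0] using hqy
          simpa using this
        have ht0 : |t| ≤ 0 := by
          rcases hslab with h | h
          · rw [hq0, sub_zero] at h; simpa [h0] using h
          · rw [hq0, neg_zero, sub_zero] at h; simpa [h0] using h
        have hw0 : w = 0 := by
          rw [h0, norm_zero, zero_add] at hwyt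
          exact norm_le_zero_iff.1 (hwyt.trans ht0)
        have hne : -((n : ℝ) + s) ≠ 0 := by linarith
        rw [hw0, symKernel, norm_zero, Real.zero_rpow hne, mul_zero, abs_zero]
        positivity
      · exact (abs_symKernel_le s E x w).trans
          (Real.rpow_le_rpow_of_nonpos (norm_pos_iff.2 h0) hyw (by linarith))
    have hk' : |{w : RSpace n | ‖(Ψ w).fst‖ < δ ∧ |(Ψ w).snd| < δ}.indicator
        (symKernel s E x) w| ≤ ‖y‖ ^ (-((n : ℝ) + s)) := by
      rw [indicator]
      split_ifs
      · exact hk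
      · rw [abs_zero]; positivity
    refine (abs_sub _ _).trans ?_
    linarith
  · have hslab' := not_or.1 hslab
    have hy2 := sq_nonneg ‖y‖
    have hκy : 0 ≤ κ * ‖y‖ ^ 2 := by positivity
    by_cases htδ : |t| < δ
    swap
    · have h1 : {w : RSpace n | ‖(Ψ w).fst‖ < δ ∧ |(Ψ w).snd| < δ}.indicator
          (symKernel s E x) w = 0 := indicator_of_notMem (fun h => htδ h.2) _
      have hqδ : |q y| ≤ δ := by
        refine hqy.trans ?_
        calc K * ‖y‖ ^ 2 ≤ K * δ ^ 2 := by gcongr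
          _ = K * δ * δ := by ring
          _ ≤ 1 * δ := by gcongr
          _ = δ := one_mul _
      have h2 : modelWeight q s δ (y, t) = 0 :=
        indicator_of_notMem (fun h => htδ (lt_of_lt_of_le h.2 hqδ)) _
      rw [h1, h2, sub_zero, abs_zero]
      positivity
    rw [indicator_of_mem (show w ∈ {w : RSpace n | ‖(Ψ w).fst‖ < δ ∧ |(Ψ w).snd| < δ} from
      ⟨hyδ, htδ⟩)]
    have hw2 : ‖w‖ < 2 * δ := by linarith
    have hp1 := hpin w hw2
    have hp2 := hpin (-w) (by rwa [norm_neg])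
    simp only [norm_neg, inner_neg_left, map_neg, inner_neg_right, neg_neg, ← sub_eq_add_neg,
      ← hin] at hp1 hp2
    have hω0 := norm_nonneg w
    have up : q y + κ * ‖y‖ ^ 2 < t → sideSign E (x + w) = -1 := fun h =>
      sideSign_of_mem (hp1.1 (paraboloid_lt_of_lt hK hε.le hε1 hδε hδK hqy hQ hsq hω0 hw2.le h))
    have dn : t < q y - κ * ‖y‖ ^ 2 → sideSign E (x + w) = 1 := fun h => by
      refine sideSign_of_notMem (hp1.2 ?_)
      have := paraboloid_lt_of_lt (q := -q y) (Q := -inner ℝ (A w) w) (t := -t) (y := ‖y‖)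
        (ω := ‖w‖) hK hε.le hε1 hδε hδK (by rwa [abs_neg])
        (by rw [abs_neg, ← abs_neg]; convert hQ using 2; ring) (by rw [hsq]; ring) hω0 hw2.le
        (by linarith)
      linarith
    have up' : t < -q y - κ * ‖y‖ ^ 2 → sideSign E (x - w) = -1 := fun h => by
      refine sideSign_of_mem (hp2.1 ?_)
      exact paraboloid_lt_of_lt (q := q y) (t := -t) (y := ‖y‖)
        hK hε.le hε1 hδε hδK hqy (by rwa [abs_neg]) (by rw [hsq]; ring) hω0 hw2.le
        (by linarith)
    have dn' : -q y + κ * ‖y‖ ^ 2 < t → sideSign E (x - w) = 1 := fun h => by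
      refine sideSign_of_notMem (hp2.2 ?_)
      have := paraboloid_lt_of_lt (q := -q y) (Q := -inner ℝ (A w) w) (t := t) (y := ‖y‖)
        (ω := ‖w‖) hK hε.le hε1 hδε hδK (by rwa [abs_neg])
        (by rw [← abs_neg]; convert hQ using 2; ring) hsq hω0 hw2.le
        (by linarith)
      linarith
    have c1 : q y + κ * ‖y‖ ^ 2 < t ∨ t < q y - κ * ‖y‖ ^ 2 := by
      rcases lt_abs.1 (not_le.1 hslab'.1) with h | h
      · left; linarith
      · right; linarith
    have c2 : -q y + κ * ‖y‖ ^ 2 < t ∨ t < -q y - κ * ‖y‖ ^ 2 := by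
      rcases lt_abs.1 (not_le.1 hslab'.2) with h | h
      · left; linarith
      · right; linarith
    -- off the slabs the even part of the sign is that of the model
    have hG : (|t| < |q y| → (sideSign E (x + w) + sideSign E (x - w)) / 2 = q y / |q y|) ∧
        (¬ |t| < |q y| → (sideSign E (x + w) + sideSign E (x - w)) / 2 = 0) := by
      rcases c1 with h1 | h1 <;> rcases c2 with h2 | h2
      · have hle : ¬ |t| < |q y| := not_lt.2 ((abs_le.2 ⟨by linarith, by linarith⟩).trans
          (le_abs_self t))
        exact ⟨fun h => absurd h hle, fun _ => by rw [up h1, dn' h2]; norm_num⟩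
      · have hneg : q y < 0 := by linarith
        have hlt : |t| < |q y| := by
          rw [abs_of_neg hneg]; exact abs_lt.2 ⟨by linarith, by linarith⟩
        refine ⟨fun _ => ?_, fun h => absurd hlt h⟩
        rw [up h1, up' h2, abs_of_neg hneg, div_neg, div_self hneg.ne]; norm_num
      · have hpos : 0 < q y := by linarith
        have hlt : |t| < |q y| := by
          rw [abs_of_pos hpos]; exact abs_lt.2 ⟨by linarith, by linarith⟩
        refine ⟨fun _ => ?_, fun h => absurd hlt h⟩
        rw [dn h1, dn' h2, abs_of_pos hpos, div_self hpos.ne']; norm_num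
      · have hle : ¬ |t| < |q y| := not_lt.2 ((abs_le.2 ⟨by linarith, by linarith⟩).trans
          (neg_le_abs t))
        exact ⟨fun h => absurd h hle, fun _ => by rw [dn h1, up' h2]; norm_num⟩
    by_cases htq : |t| < |q y|
    · have hy0 : 0 < ‖y‖ := by
        rcases (norm_nonneg y).eq_or_lt with h | h
        · rw [← h] at hqy
          have h0 := abs_nonneg t
          have : K * (0 : ℝ) ^ 2 = 0 := by ring
          linarith
        · exact h
      have htK : |t| ≤ K * ‖y‖ ^ 2 := htq.le.trans hqy
      have hmod : modelWeight q s δ (y, t) = q y / |q y| * ‖y‖ ^ (-((n : ℝ) + s)) := by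
        rw [modelWeight, indicator_of_mem (show (y, t) ∈ {z : RSpace (n - 1) × ℝ |
          ‖z.1‖ < δ ∧ |z.2| < |q z.1|} from ⟨hyδ, htq⟩), hp]
      have hslab0 : slabWeight (fun _ => 0) K 1 s δ (y, t) = ‖y‖ ^ (-((n : ℝ) + s)) := by
        rw [slabWeight_of_mem hyδ (by rwa [sub_zero, hpow]), hp]
      have hker := rpow_neg_sub_le_of_le_add_sq (n := n + 1) (p := n + s) hK hKδ hy0 hyδ hyw
        (by linarith) (by linarith) (by push_cast; linarith)
      rw [symKernel, hG.1 htq, hmod, ← mul_sub, abs_mul, abs_sub_comm, abs_of_nonneg hker.1]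
      calc _ ≤ ‖y‖ ^ (-((n : ℝ) + s)) - ‖w‖ ^ (-((n : ℝ) + s)) :=
            mul_le_of_le_one_left hker.1 (abs_div_abs_self_le _)
        _ ≤ (n + 1) * (K * δ) * slabWeight (fun _ => 0) K 1 s δ (y, t) := by
            rw [hslab0]; simpa using hker.2
        _ ≤ _ := by linarith
    · have hmod : modelWeight q s δ (y, t) = 0 := indicator_of_notMem (fun h => htq h.2) _
      rw [symKernel, hG.2 htq, hmod, zero_mul, sub_zero, abs_zero]
      positivity

/-- The fractional curvature of a set pinched along a paraboloid `⟪w, ν⟫ = ⟪A w, w⟫`: its singular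
part as `s → 1` is given by the trace of `A` on the tangent hyperplane. -/
theorem abs_integral_symKernel_sub_le {n : ℕ} {E : Set (RSpace n)} (Φ : OrthoCoords n)
    {x ν : RSpace n} (hν : ‖ν‖ = 1) {A : RSpace n →L[ℝ] RSpace n}
    {K ε δ s : ℝ} (hA : ‖A‖ ≤ K) (hε1 : ε ≤ 1) (hδ : 0 < δ) (hδε : δ ≤ ε)
    (hδK : (2 * K + 2) * δ ≤ 1 / 8) (hs : 0 < s) (hs1 : s < 1)
    (hpin : IsPinched E x ν (fun w => inner ℝ (A w) w) (fun w => ε * ‖w‖ ^ 2) (2 * δ))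
    (hint : Integrable (symKernel s E x)) :
    |(∫ w, symKernel s E x w) - 2 * ((LinearMap.trace ℝ (RSpace n) (A : RSpace n →ₗ[ℝ] RSpace n) -
        inner ℝ (A ν) ν) / (n - 1 : ℕ)) * (sphereArea (n - 1) * (δ ^ (1 - s) / (1 - s)))| ≤
      (8 * (4 * K * (2 * K + 2) + 2) + 2 * (n + 1) * K ^ 2) * ε *
        (sphereArea (n - 1) * (δ ^ (1 - s) / (1 - s))) + sphereArea n * (δ ^ (-s) / s) := by
  obtain ⟨Ψ, hΨ⟩ := Φ.exists_map_eq hν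
  have hK : 0 ≤ K := (norm_nonneg A).trans hA
  have hε : 0 < ε := hδ.trans_le hδε
  set q : RSpace (n - 1) → ℝ := fun y => inner ℝ (A (Ψ.lift y)) (Ψ.lift y) with hq
  set κ := (4 * K * (2 * K + 2) + 2) * ε with hκ
  have hκ0 : 0 ≤ κ := by positivity
  have hqK : ∀ y, |q y| ≤ K * ‖y‖ ^ 2 := fun y => by
    have := abs_inner_map_self_le hA (Ψ.lift y)
    rwa [Ψ.norm_lift] at this
  have hqm : Measurable q := by
    have : Continuous q := by
      have h1 := Ψ.lift.continuous
      have h2 := A.continuous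
      exact (h2.comp h1).inner h1
    exact this.measurable
  set cyl : Set (RSpace n) := {w | ‖(Ψ w).fst‖ < δ ∧ |(Ψ w).snd| < δ} with hcyl
  have hcylm : MeasurableSet cyl :=
    Ψ.measurePreserving_prodMk.measurable
      ((measurableSet_lt measurable_fst.norm measurable_const).inter
        (measurableSet_lt measurable_snd.abs measurable_const) :
        MeasurableSet ({z : RSpace (n - 1) × ℝ | ‖z.1‖ < δ} ∩ {z | |z.2| < δ}))
  set V := sphereArea (n - 1) * (δ ^ (1 - s) / (1 - s)) with hV
  have hV0 : 0 ≤ V := mul_nonneg (sphereArea_nonneg _)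
    (div_nonneg (by positivity) (by linarith))
  have hmodel := integral_modelWeight (q := q) (fun y => Ψ.inner_lift_eq_sum A y) hK hqK hs hs1 hδ
  rw [OrthoCoords.sum_inner_lift hΨ] at hmodel
  have hm := Ψ.integrable_comp_and_integral hmodel.1
  have hB1 := integrable_slabWeight (c := q) hqm hκ0 (by norm_num) hs1 hδ
  have hB2 := integrable_slabWeight (c := fun y => -q y) hqm.neg hκ0 (by norm_num) hs1 hδ
  have hB3 := integrable_slabWeight (m := n - 1) (c := fun _ => 0) measurable_const hK
    (by norm_num) hs1 hδ
  have hC1 := Ψ.integrable_comp_and_integral hB1.1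
  have hC2 := Ψ.integrable_comp_and_integral hB2.1
  have hC3 := Ψ.integrable_comp_and_integral hB3.1
  have hcylint : Integrable (cyl.indicator (symKernel s E x)) := hint.indicator hcylm
  have hnear : |(∫ w in cyl, symKernel s E x w) - ∫ z, modelWeight q s δ z| ≤
      2 * (2 * κ * V + 2 * κ * V) + (n + 1) * (K * δ) * (2 * K * V) := by
    rw [← hm.2, ← integral_indicator hcylm, ← integral_sub hcylint hm.1, ← Real.norm_eq_abs]
    refine (norm_integral_le_of_norm_le (((hC1.1.add hC2.1).const_mul 2).add
      (hC3.1.const_mul ((n + 1) * (K * δ)))) (Eventually.of_forall fun w =>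
        abs_symKernel_sub_modelWeight_le hΨ hA hε1 hδ hδε hδK hs hs1 hpin w)).trans ?_
    rw [integral_add' ((hC1.1.add hC2.1).const_mul 2) (hC3.1.const_mul _), integral_const_mul,
      integral_const_mul, integral_add' hC1.1 hC2.1, hC1.2, hC2.2, hC3.2]
    have b1 := hB1.2
    have b2 := hB2.2
    have b3 := hB3.2
    gcongr
  have hfar : |∫ w in cylᶜ, symKernel s E x w| ≤ sphereArea n * (δ ^ (-s) / s) := by
    have hsub : cylᶜ ⊆ (Metric.ball (0 : RSpace n) δ)ᶜ := by
      refine compl_subset_compl.2 fun w hw => ?_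
      have hw' : ‖w‖ < δ := by simpa using hw
      exact ⟨(Ψ.norm_fst_le w).trans_lt hw', (Ψ.abs_snd_le w).trans_lt hw'⟩
    have h := integrableOn_norm_rpow_compl_ball n hs hδ
    rw [← h.2, ← Real.norm_eq_abs]
    refine (norm_integral_le_of_norm_le (h.1.mono_set hsub)
      (Eventually.of_forall fun w => abs_symKernel_le s E x w)).trans ?_
    exact setIntegral_mono_set h.1 (Eventually.of_forall fun w => by positivity)
      hsub.eventuallyLE
  rw [hmodel.2] at hnear
  rw [← integral_add_compl hcylm hint]
  have hbound : 2 * (2 * κ * V + 2 * κ * V) + (n + 1) * (K * δ) * (2 * K * V) ≤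
      (8 * (4 * K * (2 * K + 2) + 2) + 2 * (n + 1) * K ^ 2) * ε * V := by
    have : (n + 1) * (K * δ) * (2 * K * V) ≤ (n + 1) * (K * ε) * (2 * K * V) := by gcongr
    rw [hκ]
    linarith
  have h1 := abs_le.1 hnear
  have h2 := abs_le.1 hfar
  rw [abs_le]
  constructor <;> linarith

/-! ### Second order expansion of a graph -/

/-- The divergence form of the mean curvature, expanded: the derivative of `(1 + |∇u|²)^{-1/2} ∇u`
is a multiple of the Hessian plus an operator of rank one. -/
theorem graphMeanCurvature_eq {m : ℕ} {u : RSpace m → ℝ} {z : RSpace m}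
    (hG : DifferentiableAt ℝ (gradient u) z) :
    graphMeanCurvature u z = (m : ℝ)⁻¹ * ((Real.sqrt (1 + ‖gradient u z‖ ^ 2))⁻¹ *
      LinearMap.trace ℝ (RSpace m) (fderiv ℝ (gradient u) z : RSpace m →ₗ[ℝ] RSpace m) -
      (Real.sqrt (1 + ‖gradient u z‖ ^ 2))⁻¹ ^ 3 *
        inner ℝ (fderiv ℝ (gradient u) z (gradient u z)) (gradient u z)) := by
  set D := fderiv ℝ (gradient u) z with hD
  set b := gradient u z with hb
  set J := Real.sqrt (1 + ‖b‖ ^ 2) with hJ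
  have hJ1 : 1 ≤ J := one_le_sqrt_one_add_sq _
  have hpos : 0 < 1 + ‖b‖ ^ 2 := by positivity
  have h1 : HasFDerivAt (fun w => 1 + ‖gradient u w‖ ^ 2) (2 • (innerSL ℝ b).comp D) z :=
    (hG.hasFDerivAt.norm_sq).const_add 1
  have h2 : HasDerivAt (fun r : ℝ => (Real.sqrt r)⁻¹) (-(1 / (2 * J)) / J ^ 2) (1 + ‖b‖ ^ 2) :=
    (Real.hasDerivAt_sqrt hpos.ne').inv (by positivity)
  have h3 := h2.comp_hasFDerivAt z h1
  have h4 := (h3.smul hG.hasFDerivAt).fderiv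
  rw [graphMeanCurvature]
  congr 1
  have h5 : fderiv ℝ (fun w => (Real.sqrt (1 + ‖gradient u w‖ ^ 2))⁻¹ • gradient u w) z =
      J⁻¹ • D + ((-(1 / (2 * J)) / J ^ 2) • (2 • (innerSL ℝ b).comp D)).smulRight b := h4
  rw [h5]
  have h6 : ((J⁻¹ • D + ((-(1 / (2 * J)) / J ^ 2) • (2 • (innerSL ℝ b).comp D)).smulRight b :
      RSpace m →L[ℝ] RSpace m) : RSpace m →ₗ[ℝ] RSpace m) =
      J⁻¹ • (D : RSpace m →ₗ[ℝ] RSpace m) +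
      (((-(1 / (2 * J)) / J ^ 2) • (2 • (innerSL ℝ b).comp D) :
        RSpace m →L[ℝ] ℝ) : RSpace m →ₗ[ℝ] ℝ).smulRight b := rfl
  rw [h6, map_add, map_smul, LinearMap.trace_smulRight, smul_eq_mul]
  have h7 : (((-(1 / (2 * J)) / J ^ 2) • (2 • (innerSL ℝ b).comp D) :
        RSpace m →L[ℝ] ℝ) : RSpace m →ₗ[ℝ] ℝ) b =
      (-(1 / (2 * J)) / J ^ 2) * (2 * inner ℝ b (D b)) := by
    simp
  rw [h7, real_inner_comm]
  field_simp
  ring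

/-- Half the second fundamental form at the origin of the graph of `u`, extended by zero in the
vertical direction of the coordinates `Φ`: the Hessian divided by `2 √(1 + |∇u|²)`. -/
noncomputable def graphForm {n : ℕ} (Φ : OrthoCoords n) (u : RSpace (n - 1) → ℝ) :
    RSpace n →L[ℝ] RSpace n :=
  (2 * Real.sqrt (1 + ‖gradient u 0‖ ^ 2))⁻¹ • (Φ.lift ∘L fderiv ℝ (gradient u) 0 ∘L
    (WithLp.fstL 2 ℝ (RSpace (n - 1)) ℝ ∘L
      (Φ.toContinuousLinearEquiv : RSpace n →L[ℝ] WithLp 2 (RSpace (n - 1) × ℝ))))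

theorem graphForm_apply {n : ℕ} (Φ : OrthoCoords n) (u : RSpace (n - 1) → ℝ) (w : RSpace n) :
    graphForm Φ u w = (2 * Real.sqrt (1 + ‖gradient u 0‖ ^ 2))⁻¹ •
      Φ.lift (fderiv ℝ (gradient u) 0 (Φ w).fst) := rfl

theorem inner_graphForm {n : ℕ} (Φ : OrthoCoords n) (u : RSpace (n - 1) → ℝ) (w : RSpace n) :
    inner ℝ (graphForm Φ u w) w = (2 * Real.sqrt (1 + ‖gradient u 0‖ ^ 2))⁻¹ *
      inner ℝ (fderiv ℝ (gradient u) 0 (Φ w).fst) (Φ w).fst := by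
  rw [graphForm_apply, inner_smul_left, Φ.inner_lift]
  simp

theorem trace_graphForm {n : ℕ} (Φ : OrthoCoords n) (u : RSpace (n - 1) → ℝ) :
    LinearMap.trace ℝ (RSpace n) (graphForm Φ u : RSpace n →ₗ[ℝ] RSpace n) =
      (2 * Real.sqrt (1 + ‖gradient u 0‖ ^ 2))⁻¹ * LinearMap.trace ℝ (RSpace (n - 1))
        (fderiv ℝ (gradient u) 0 : RSpace (n - 1) →ₗ[ℝ] RSpace (n - 1)) := by
  have h := OrthoCoords.sum_inner_lift (Ψ := Φ) (Φ.apply_symm_apply (WithLp.toLp 2 (0, 1)))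
    (graphForm Φ u)
  have h0 : inner ℝ (graphForm Φ u (Φ.symm (WithLp.toLp 2 (0, 1))))
      (Φ.symm (WithLp.toLp 2 (0, 1))) = 0 := by
    rw [inner_graphForm, Φ.apply_symm_apply]; simp
  rw [h0, sub_zero] at h
  rw [← h, LinearMap.trace_eq_sum_inner _ (EuclideanSpace.basisFun (Fin (n - 1)) ℝ),
    Finset.mul_sum]
  refine Finset.sum_congr rfl fun i _ => ?_
  rw [inner_graphForm, Φ.lift_apply, Φ.apply_symm_apply, real_inner_comm]
  simp

/-- The mean curvature of a graph is twice the average, over the tangent hyperplane, of the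
quadratic form `graphForm`. -/
theorem graphMeanCurvature_eq_graphForm {n : ℕ} (Φ : OrthoCoords n) {u : RSpace (n - 1) → ℝ}
    (hG : DifferentiableAt ℝ (gradient u) 0) :
    graphMeanCurvature u 0 = 2 * ((LinearMap.trace ℝ (RSpace n)
      (graphForm Φ u : RSpace n →ₗ[ℝ] RSpace n) -
      inner ℝ (graphForm Φ u (graphNormal Φ (gradient u 0))) (graphNormal Φ (gradient u 0))) /
        (n - 1 : ℕ)) := by
  have hν : (Φ (graphNormal Φ (gradient u 0))).fst =
      -((Real.sqrt (1 + ‖gradient u 0‖ ^ 2))⁻¹ • gradient u 0) := by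
    rw [graphNormal, map_smul, Φ.apply_symm_apply]
    simp
  rw [graphMeanCurvature_eq hG, trace_graphForm, inner_graphForm, hν, map_neg, inner_neg_neg,
    map_smul, inner_smul_left, inner_smul_right]
  have := one_le_sqrt_one_add_sq ‖gradient u 0‖
  simp only [conj_trivial, mul_inv]
  ring

/-- Near a point of a `C²` boundary, the set is pinched, at every boundary point, along a paraboloid
whose quadratic form does not depend on the point. -/
theorem exists_isPinched_of_contDiffOn_two {n : ℕ} {E : Set (RSpace n)} {x₀ : RSpace n}
    {Φ : OrthoCoords n} {r h : ℝ} {u : RSpace (n - 1) → ℝ} (hrep : IsLocalSupergraph E x₀ Φ r h u)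
    (hu : ContDiffOn ℝ 2 u (Metric.ball 0 r)) {ε : ℝ} (hε : 0 < ε) :
    ∃ δ : ℝ, 0 < δ ∧ ∀ x ∈ frontier E, ‖x - x₀‖ < δ → ∃ ν : RSpace n, ‖ν‖ = 1 ∧
      ‖ν - graphNormal Φ (gradient u 0)‖ ≤ ε ∧
      IsPinched E x ν (fun w => inner ℝ (graphForm Φ u w) w) (fun w => ε * ‖w‖ ^ 2) δ := by
  have hr := hrep.1
  have hh := hrep.2.1
  have hG : ContDiffAt ℝ 1 (gradient u) 0 :=
    (contDiffOn_gradient hu).contDiffAt (Metric.isOpen_ball.mem_nhds (by simpa using hr))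
  set D := fderiv ℝ (gradient u) 0 with hD
  set J₀ := Real.sqrt (1 + ‖gradient u 0‖ ^ 2) with hJ₀
  have hJ₀1 : 1 ≤ J₀ := one_le_sqrt_one_add_sq _
  have hstrict := (hG.hasStrictFDerivAt one_ne_zero).isLittleO.bound (half_pos hε)
  rw [nhds_prod_eq] at hstrict
  obtain ⟨δ₁, hδ₁, H₁⟩ := (Metric.nhds_basis_ball.prod_self.eventually_iff).1 hstrict
  have hJlim : Tendsto (fun a => |Real.sqrt (1 + ‖gradient u a‖ ^ 2) - J₀| * ‖D‖) (𝓝 0) (𝓝 0) := by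
    have h1 : ContinuousAt (fun a => |Real.sqrt (1 + ‖gradient u a‖ ^ 2) - J₀| * ‖D‖) 0 :=
      ((((hG.continuousAt.norm.pow 2).const_add 1).sqrt.sub continuousAt_const).abs).mul
        continuousAt_const
    have h2 := h1.tendsto
    simpa [hJ₀] using h2
  have hNlim : Tendsto (fun a => ‖graphNormal Φ (gradient u a) - graphNormal Φ (gradient u 0)‖)
      (𝓝 0) (𝓝 0) := by
    have h1 : ContinuousAt
        (fun a => ‖graphNormal Φ (gradient u a) - graphNormal Φ (gradient u 0)‖) 0 :=
      (((continuous_graphNormal Φ).continuousAt.comp hG.continuousAt).sub continuousAt_const).norm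
    have h2 := h1.tendsto
    simpa using h2
  obtain ⟨δ₂, hδ₂, H₂⟩ := Metric.eventually_nhds_iff_ball.1
    ((hJlim.eventually (gt_mem_nhds hε)).and (hNlim.eventually (gt_mem_nhds hε)))
  set δ := min (min (r / 2) (h / 2)) (min (δ₁ / 2) δ₂) with hδ
  have hδr : δ ≤ r / 2 := (min_le_left _ _).trans (min_le_left _ _)
  have hδh : δ ≤ h / 2 := (min_le_left _ _).trans (min_le_right _ _)
  have hδδ₁ : δ ≤ δ₁ / 2 := (min_le_right _ _).trans (min_le_left _ _)
  have hδδ₂ : δ ≤ δ₂ := (min_le_right _ _).trans (min_le_right _ _)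
  refine ⟨δ, by positivity, fun x hx hxδ => ?_⟩
  have hd1 : ‖(Φ (x - x₀)).fst‖ < δ := (Φ.norm_fst_le _).trans_lt hxδ
  have hd2 : |(Φ (x - x₀)).snd| < h / 2 := (Φ.abs_snd_le _).trans_lt (hxδ.trans_le hδh)
  have heq := hrep.snd_eq_of_mem_frontier hu.continuousOn hx (by linarith) (by linarith)
  set a := (Φ (x - x₀)).fst with ha
  obtain ⟨hJa, hNa⟩ := H₂ a (by rw [mem_ball_zero_iff]; linarith)
  refine ⟨_, norm_graphNormal Φ (gradient u a), hNa.le,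
    hrep.isPinched (by linarith) hd2 heq _ hδr hδh fun w hw => ?_⟩
  set J := Real.sqrt (1 + ‖gradient u a‖ ^ 2) with hJ
  have hJ1 : 1 ≤ J := one_le_sqrt_one_add_sq _
  have hw1 : ‖(Φ w).fst‖ < δ := (Φ.norm_fst_le w).trans_lt hw
  have hseg : ∀ t ∈ Icc (0 : ℝ) 1, ‖a + t • (Φ w).fst‖ < 2 * δ := by
    intro t ht
    refine (norm_add_le _ _).trans_lt ?_
    rw [norm_smul, Real.norm_of_nonneg ht.1]
    nlinarith [norm_nonneg (Φ w).fst, ht.2]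
  have key := abs_taylor_le (u := u) (a := a) (w := (Φ w).fst) (b := gradient u a) D
    (M := ε / 2 * ‖w‖ ^ 2) (fun t ht => (hu.differentiableOn two_ne_zero).differentiableAt
      (Metric.isOpen_ball.mem_nhds (by
        rw [mem_ball_zero_iff]; linarith [hseg t ht]))) (fun t ht => ?_)
  · rw [inner_graphForm]
    have hDw : |inner ℝ (D (Φ w).fst) (Φ w).fst| ≤ ‖D‖ * ‖w‖ ^ 2 := by
      refine (abs_inner_map_self_le le_rfl _).trans ?_
      gcongr
      exact Φ.norm_fst_le w
    have hsplit : J * ((2 * J₀)⁻¹ * inner ℝ (D (Φ w).fst) (Φ w).fst) =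
        2⁻¹ * inner ℝ (D (Φ w).fst) (Φ w).fst +
          (J - J₀) * J₀⁻¹ * 2⁻¹ * inner ℝ (D (Φ w).fst) (Φ w).fst := by
      have : J₀ ≠ 0 := by linarith
      field_simp
      ring
    have herr : |(J - J₀) * J₀⁻¹ * 2⁻¹ * inner ℝ (D (Φ w).fst) (Φ w).fst| ≤ ε / 2 * ‖w‖ ^ 2 := by
      rw [abs_mul, abs_mul, abs_mul, abs_of_nonneg (by positivity : (0 : ℝ) ≤ J₀⁻¹),
        abs_of_nonneg (by norm_num : (0 : ℝ) ≤ 2⁻¹)]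
      calc _ ≤ |J - J₀| * 1 * 2⁻¹ * (‖D‖ * ‖w‖ ^ 2) := by
            gcongr
            exact inv_le_one_of_one_le₀ hJ₀1
        _ = (|J - J₀| * ‖D‖) * (2⁻¹ * ‖w‖ ^ 2) := by ring
        _ ≤ ε * (2⁻¹ * ‖w‖ ^ 2) := by gcongr
        _ = _ := by ring
    rw [hsplit]
    have hfin : ε * ‖w‖ ^ 2 ≤ J * (ε * ‖w‖ ^ 2) := le_mul_of_one_le_left (by positivity) hJ1
    have k1 := abs_le.1 key
    have k2 := abs_le.1 herr
    rw [abs_le]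
    constructor <;> linarith
  · have h0 := H₁ (x := (a + t • (Φ w).fst, a)) (mk_mem_prod
      (by rw [mem_ball_zero_iff]; linarith [hseg t ht]) (by rw [mem_ball_zero_iff]; linarith))
    simp only [add_sub_cancel_left, map_smul] at h0
    have h1 : ‖t • (Φ w).fst‖ ≤ ‖w‖ := by
      rw [norm_smul, Real.norm_of_nonneg ht.1]
      nlinarith [norm_nonneg (Φ w).fst, ht.2, Φ.norm_fst_le w]
    calc _ ≤ (ε / 2 * ‖w‖) * ‖w‖ := by
          gcongr
          · exact h0.trans (by gcongr)
          · exact Φ.norm_fst_le w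
      _ = _ := by ring

/-! ### The limit `s → 1` -/

theorem abs_inner_map_self_sub_le {n : ℕ} (A : RSpace n →L[ℝ] RSpace n) {ν ν₀ : RSpace n}
    (hν : ‖ν‖ = 1) (hν₀ : ‖ν₀‖ = 1) :
    |inner ℝ (A ν) ν - inner ℝ (A ν₀) ν₀| ≤ 2 * ‖A‖ * ‖ν - ν₀‖ := by
  have h1 : inner ℝ (A ν) ν - inner ℝ (A ν₀) ν₀ =
      inner ℝ (A (ν - ν₀)) ν + inner ℝ (A ν₀) (ν - ν₀) := by
    rw [map_sub, inner_sub_left, inner_sub_right]; ring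
  rw [h1]
  calc _ ≤ |inner ℝ (A (ν - ν₀)) ν| + |inner ℝ (A ν₀) (ν - ν₀)| := abs_add_le _ _
    _ ≤ ‖A (ν - ν₀)‖ * ‖ν‖ + ‖A ν₀‖ * ‖ν - ν₀‖ :=
        add_le_add (abs_real_inner_le_norm _ _) (abs_real_inner_le_norm _ _)
    _ ≤ (‖A‖ * ‖ν - ν₀‖) * ‖ν‖ + (‖A‖ * ‖ν₀‖) * ‖ν - ν₀‖ := by
        gcongr <;> exact A.le_opNorm _
    _ = _ := by rw [hν, hν₀]; ring

/-- As `s → 1` and `x → x₀` along the boundary, the rescaled fractional curvature converges to the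
mean curvature computed in any local graph representation at `x₀`. -/
theorem IsC2BoundaryIn.tendsto_rescaled {n : ℕ} {E U : Set (RSpace n)}
    (hE : NullMeasurableSet E volume) (hreg : IsC2BoundaryIn E U) {x₀ : RSpace n} {κ : ℝ}
    (hκ : IsMeanCurvatureAt E x₀ κ) :
    Tendsto (fun q : ℝ × RSpace n => q.1 * (1 - q.1) * fracCurvature q.1 E q.2)
      (𝓝[Ioo 0 1 ×ˢ (frontier E ∩ U)] (1, x₀)) (𝓝 (sphereArea (n - 1) * κ)) := by
  obtain ⟨Φ, r, h, u, hrep, hu, rfl⟩ := hκ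
  have hGd : DifferentiableAt ℝ (gradient u) 0 :=
    ((contDiffOn_gradient hu).contDiffAt
      (Metric.isOpen_ball.mem_nhds (by simpa using hrep.1))).differentiableAt one_ne_zero
  have hH := graphMeanCurvature_eq_graphForm Φ hGd
  set A := graphForm Φ u with hA
  set ν₀ := graphNormal Φ (gradient u 0) with hν₀
  set H := graphMeanCurvature u 0 with hHdef
  set V := sphereArea (n - 1) with hV
  have hV0 : 0 ≤ V := sphereArea_nonneg _
  set C := 8 * (4 * ‖A‖ * (2 * ‖A‖ + 2) + 2) + 2 * (n + 1) * ‖A‖ ^ 2 with hC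
  have hC0 : 0 ≤ C := by positivity
  set m : ℝ := ((n - 1 : ℕ) : ℝ) with hm
  have hm0 : 0 ≤ m := Nat.cast_nonneg _
  rw [Metric.tendsto_nhds]
  intro e he
  -- the error allowed in the pinching condition
  obtain ⟨ε, hε, hε1, hεe⟩ : ∃ ε : ℝ, 0 < ε ∧ ε ≤ 1 ∧ (4 * ‖A‖ / m + C) * ε * V < e := by
    set B := (4 * ‖A‖ / m + C) * V with hB
    have hB0 : 0 ≤ B := by positivity
    refine ⟨min 1 (e / (B + 1)), by positivity, min_le_left _ _, ?_⟩
    calc (4 * ‖A‖ / m + C) * min 1 (e / (B + 1)) * V = B * min 1 (e / (B + 1)) := by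
          rw [hB]; ring
      _ ≤ B * (e / (B + 1)) := by gcongr; exact min_le_right _ _
      _ < e := by
          rw [mul_div_assoc', div_lt_iff₀ (by positivity)]
          nlinarith
  obtain ⟨δ', hδ', Hpin⟩ := exists_isPinched_of_contDiffOn_two hrep hu hε
  set δ := min (min ε (δ' / 2)) (1 / (8 * (2 * ‖A‖ + 2))) with hδ
  have hδ0 : 0 < δ := by positivity
  have hδε : δ ≤ ε := (min_le_left _ _).trans (min_le_left _ _)
  have hδδ' : 2 * δ ≤ δ' := by
    have : δ ≤ δ' / 2 := (min_le_left _ _).trans (min_le_right _ _)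
    linarith
  have hδK : (2 * ‖A‖ + 2) * δ ≤ 1 / 8 := by
    have : δ ≤ 1 / (8 * (2 * ‖A‖ + 2)) := min_le_right _ _
    rw [le_div_iff₀ (by positivity)] at this
    linarith
  set R : ℝ → ℝ := fun s => |H| * V * |δ ^ (1 - s) - 1| + (4 * ‖A‖ / m + C) * ε * V +
    (1 - s) * (sphereArea n * (δ ^ (-s) / s)) + (1 - s) * (V * |H|) with hR
  have hRlim : Tendsto R (𝓝 1) (𝓝 ((4 * ‖A‖ / m + C) * ε * V)) := by
    have h1 : ContinuousAt R 1 := by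
      have k1 : ContinuousAt (fun s : ℝ => δ ^ (1 - s)) 1 :=
        continuousAt_const.rpow (continuousAt_const.sub continuousAt_id) (Or.inl hδ0.ne')
      have k2 : ContinuousAt (fun s : ℝ => δ ^ (-s)) 1 :=
        continuousAt_const.rpow continuousAt_id.neg (Or.inl hδ0.ne')
      have k3 : ContinuousAt (fun s : ℝ => 1 - s) 1 := continuousAt_const.sub continuousAt_id
      exact (((continuousAt_const.mul (k1.sub continuousAt_const).abs).add continuousAt_const).add
        (k3.mul (continuousAt_const.mul (k2.div continuousAt_id one_ne_zero)))).add
        (k3.mul continuousAt_const)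
    have h2 := h1.tendsto
    have h3 : R 1 = (4 * ‖A‖ / m + C) * ε * V := by simp [hR]
    rwa [h3] at h2
  have hmem : ∀ᶠ q in 𝓝[Ioo 0 1 ×ˢ (frontier E ∩ U)] ((1 : ℝ), x₀),
      q ∈ Ioo (0 : ℝ) 1 ×ˢ (frontier E ∩ U) := self_mem_nhdsWithin
  have hfst : Tendsto (fun q : ℝ × RSpace n => q.1)
      (𝓝[Ioo 0 1 ×ˢ (frontier E ∩ U)] ((1 : ℝ), x₀)) (𝓝 1) :=
    (continuous_fst.tendsto ((1 : ℝ), x₀)).mono_left nhdsWithin_le_nhds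
  have hsnd : ∀ᶠ q in 𝓝[Ioo 0 1 ×ˢ (frontier E ∩ U)] ((1 : ℝ), x₀), ‖q.2 - x₀‖ < δ' := by
    have : Tendsto (fun q : ℝ × RSpace n => ‖q.2 - x₀‖)
        (𝓝[Ioo 0 1 ×ˢ (frontier E ∩ U)] ((1 : ℝ), x₀)) (𝓝 ‖x₀ - x₀‖) :=
      ((continuous_snd.sub continuous_const).norm.tendsto ((1 : ℝ), x₀)).mono_left
        nhdsWithin_le_nhds
    rw [sub_self, norm_zero] at this
    exact this.eventually (gt_mem_nhds hδ')
  filter_upwards [hmem, hsnd, (hRlim.comp hfst).eventually (gt_mem_nhds hεe)] with q hq hq2 hqR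
  obtain ⟨s, x⟩ := q
  obtain ⟨⟨hs, hs1⟩, hx⟩ := hq
  simp only [Function.comp_apply] at hs hs1 hx hq2 hqR ⊢
  obtain ⟨ν, hν, hνν₀, hp⟩ := Hpin x hx.1 hq2
  obtain ⟨-, hint, hI⟩ := hreg.isC1HolderBoundaryIn.hasFracCurvature hE one_pos le_rfl hx hs hs1
  have key := abs_integral_symKernel_sub_le Φ hν (A := A) le_rfl hε1 hδ0 hδε hδK hs hs1
    (fun w hw => hp w (hw.trans_le hδδ')) hint
  rw [← hI] at key
  set c := 2 * ((LinearMap.trace ℝ (RSpace n) (A : RSpace n →ₗ[ℝ] RSpace n) -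
        inner ℝ (A ν) ν) / m) with hc
  have hcH : |c - H| ≤ 4 * ‖A‖ / m * ε := by
    have h1 : c - H = 2 * (-(inner ℝ (A ν) ν - inner ℝ (A ν₀) ν₀) / m) := by
      rw [hc, hH]; ring
    rw [h1, abs_mul, abs_div, abs_neg, abs_of_nonneg hm0, abs_two]
    calc _ ≤ 2 * (2 * ‖A‖ * ε / m) := by
          gcongr
          exact (abs_inner_map_self_sub_le A hν (norm_graphNormal _ _)).trans (by gcongr)
      _ = _ := by ring
  set P := δ ^ (1 - s) with hP
  have hP0 : 0 ≤ P := by positivity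
  have hP1 : P ≤ 1 := Real.rpow_le_one hδ0.le (hδε.trans hε1) (by linarith)
  have h1s : 0 < 1 - s := by linarith
  -- multiply the estimate by `1 - s`
  have key2 : |(1 - s) * fracCurvature s E x - c * (V * P)| ≤
      C * ε * V + (1 - s) * (sphereArea n * (δ ^ (-s) / s)) := by
    have e1 : (1 - s) * fracCurvature s E x - c * (V * P) =
        (1 - s) * (fracCurvature s E x - c * (V * (P / (1 - s)))) := by
      field_simp
    rw [e1, abs_mul, abs_of_pos h1s]
    calc _ ≤ (1 - s) * (C * ε * (V * (P / (1 - s))) + sphereArea n * (δ ^ (-s) / s)) := by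
          gcongr
      _ = C * ε * (V * P) + (1 - s) * (sphereArea n * (δ ^ (-s) / s)) := by field_simp
      _ ≤ C * ε * (V * 1) + (1 - s) * (sphereArea n * (δ ^ (-s) / s)) := by gcongr
      _ = _ := by ring
  have key3 : |c * (V * P) - V * H| ≤ 4 * ‖A‖ / m * ε * V + |H| * V * |P - 1| := by
    have e1 : c * (V * P) - V * H = (c - H) * (V * P) + H * V * (P - 1) := by ring
    rw [e1]
    refine (abs_add_le _ _).trans ?_
    rw [abs_mul (c - H), abs_mul (H * V), abs_mul H, abs_of_nonneg (mul_nonneg hV0 hP0),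
      abs_of_nonneg hV0]
    gcongr
    exact mul_le_of_le_one_right hV0 hP1
  have key4 : s * (1 - s) * fracCurvature s E x - V * H =
      s * ((1 - s) * fracCurvature s E x - V * H) - (1 - s) * (V * H) := by ring
  rw [Real.dist_eq, key4]
  refine lt_of_le_of_lt ?_ hqR
  refine (abs_sub _ _).trans ?_
  have key5 : |(1 - s) * fracCurvature s E x - V * H| ≤
      C * ε * V + (1 - s) * (sphereArea n * (δ ^ (-s) / s)) +
        (4 * ‖A‖ / m * ε * V + |H| * V * |P - 1|) := by
    have := abs_add_le ((1 - s) * fracCurvature s E x - c * (V * P)) (c * (V * P) - V * H)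
    rw [sub_add_sub_cancel] at this
    linarith
  have key6 : |s * ((1 - s) * fracCurvature s E x - V * H)| ≤
      |(1 - s) * fracCurvature s E x - V * H| := by
    rw [abs_mul, abs_of_pos hs]
    exact mul_le_of_le_one_left (abs_nonneg _) hs1.le
  have key7 : |(1 - s) * (V * H)| = (1 - s) * (V * |H|) := by
    rw [abs_mul, abs_mul, abs_of_pos h1s, abs_of_nonneg hV0]
  rw [key7]
  simp only [hR]
  linarith

theorem IsC2BoundaryIn.continuousOn_rescaledCurvatureToOne {n : ℕ} {E U : Set (RSpace n)}
    (hE : NullMeasurableSet E volume) (hreg : IsC2BoundaryIn E U) :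
    ContinuousOn (fun q : ℝ × RSpace n => rescaledCurvatureToOne E q.1 q.2)
      (Ioc (0 : ℝ) 1 ×ˢ (frontier E ∩ U)) := by
  rintro ⟨s₀, x₀⟩ ⟨⟨hs₀, hs₀1⟩, hx₀⟩
  simp only at hs₀ hs₀1 hx₀
  have hunion : Ioc (0 : ℝ) 1 ×ˢ (frontier E ∩ U) =
      (Ioo 0 1 ×ˢ (frontier E ∩ U)) ∪ ({1} ×ˢ (frontier E ∩ U)) := by
    rw [← union_prod, union_singleton, Ioo_insert_right zero_lt_one]
  have heqon : EqOn (fun q : ℝ × RSpace n => rescaledCurvatureToOne E q.1 q.2)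
      (fun q => q.1 * (1 - q.1) * fracCurvature q.1 E q.2) (Ioo 0 1 ×ˢ (frontier E ∩ U)) := by
    rintro ⟨s, x⟩ ⟨⟨-, hs⟩, -⟩
    simp only at hs
    simp [rescaledCurvatureToOne, hs.ne]
  have hjoint : ∀ x ∈ frontier E ∩ U,
      Tendsto (fun q : ℝ × RSpace n => q.1 * (1 - q.1) * fracCurvature q.1 E q.2)
        (𝓝[Ioo 0 1 ×ˢ (frontier E ∩ U)] (1, x)) (𝓝 (sphereArea (n - 1) * meanCurvature E x)) :=
    fun x hx => hreg.tendsto_rescaled hE (hreg.isMeanCurvatureAt hx)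
  rcases hs₀1.eq_or_lt with rfl | hs₀1
  · rw [hunion, continuousWithinAt_union]
    have hval : rescaledCurvatureToOne E 1 x₀ = sphereArea (n - 1) * meanCurvature E x₀ := by
      simp [rescaledCurvatureToOne]
    constructor
    · rw [ContinuousWithinAt, hval]
      refine (hjoint x₀ hx₀).congr' ?_
      filter_upwards [self_mem_nhdsWithin] with q hq using (heqon hq).symm
    · -- the values at `s = 1` are limits of values at `s < 1`
      rw [ContinuousWithinAt, hval, Metric.tendsto_nhds]
      intro e he
      have h1 := (Metric.tendsto_nhds.1 (hjoint x₀ hx₀)) (e / 2) (half_pos he)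
      rw [eventually_nhdsWithin_iff, nhds_prod_eq] at h1
      obtain ⟨pa, ha, pb, hb, hab⟩ := eventually_prod_iff.1 h1
      have hsnd : ∀ᶠ q in 𝓝[{1} ×ˢ (frontier E ∩ U)] ((1 : ℝ), x₀), pb q.2 :=
        ((continuous_snd.tendsto ((1 : ℝ), x₀)).mono_left nhdsWithin_le_nhds).eventually hb
      filter_upwards [self_mem_nhdsWithin, hsnd] with q hq hqb
      obtain ⟨s, x⟩ := q
      obtain ⟨hs, hx⟩ := hq
      simp only [mem_singleton_iff] at hs hx hqb ⊢
      subst hs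
      have hpt : Tendsto (fun s : ℝ => s * (1 - s) * fracCurvature s E x) (𝓝[<] 1)
          (𝓝 (sphereArea (n - 1) * meanCurvature E x)) := by
        refine (hjoint x hx).comp (f := fun s : ℝ => (s, x)) (tendsto_nhdsWithin_iff.2 ⟨?_, ?_⟩)
        · exact (Continuous.tendsto (by fun_prop) (1 : ℝ)).mono_left nhdsWithin_le_nhds
        · filter_upwards [Ioo_mem_nhdsLT (zero_lt_one (α := ℝ))] with s hs
          exact ⟨hs, hx⟩
      have hle : dist (sphereArea (n - 1) * meanCurvature E x)
          (sphereArea (n - 1) * meanCurvature E x₀) ≤ e / 2 := by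
        refine le_of_tendsto (hpt.dist tendsto_const_nhds) ?_
        filter_upwards [nhdsWithin_le_nhds ha, Ioo_mem_nhdsLT (zero_lt_one (α := ℝ))] with s h2 hs
        exact (hab h2 hqb ⟨hs, hx⟩).le
      have hvalx : rescaledCurvatureToOne E 1 x = sphereArea (n - 1) * meanCurvature E x := by
        simp [rescaledCurvatureToOne]
      rw [hvalx]
      linarith
  · have hcont := (hreg.isC1HolderBoundaryIn.continuousOn_fracCurvature hE one_pos le_rfl)
      (s₀, x₀) ⟨⟨hs₀, hs₀1⟩, hx₀⟩
    have h1 : ContinuousWithinAt (fun q : ℝ × RSpace n =>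
        q.1 * (1 - q.1) * fracCurvature q.1 E q.2) (Ioo 0 1 ×ˢ (frontier E ∩ U)) (s₀, x₀) :=
      (Continuous.continuousWithinAt (by fun_prop)).mul hcont
    have h2 := h1.congr heqon (heqon ⟨⟨hs₀, hs₀1⟩, hx₀⟩)
    refine h2.mono_of_mem_nhdsWithin ?_
    rw [mem_nhdsWithin]
    refine ⟨Iio 1 ×ˢ univ, isOpen_Iio.prod isOpen_univ, ⟨hs₀1, mem_univ _⟩, ?_⟩
    rintro ⟨s, x⟩ ⟨⟨h1, -⟩, ⟨h2, -⟩, h4⟩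
    exact ⟨⟨h2, h1⟩, h4⟩

theorem proposition1p8 (n : ℕ) (E : Set (RSpace n)) (hE : NullMeasurableSet E volume)
    (p : RSpace n) (hp : p ∈ frontier E) (R : ℝ) (hR : 0 < R) :
    (∀ α : ℝ, 0 < α → α ≤ 1 → IsC1HolderBoundaryIn E α (Metric.ball p R) →
      (∀ s ∈ Ioo (0 : ℝ) α, ∀ x ∈ frontier E ∩ Metric.ball p R,
        HasFracCurvature s E x (fracCurvature s E x)) ∧
      ContinuousOn (fun q : ℝ × RSpace n => fracCurvature q.1 E q.2)
        (Ioo (0 : ℝ) α ×ˢ (frontier E ∩ Metric.ball p R))) ∧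
    (IsC2BoundaryIn E (Metric.ball p R) →
      (∀ s ∈ Ioo (0 : ℝ) 1, ∀ x ∈ frontier E ∩ Metric.ball p R,
        HasFracCurvature s E x (fracCurvature s E x)) ∧
      ContinuousOn (fun q : ℝ × RSpace n => rescaledCurvatureToOne E q.1 q.2)
        (Ioc (0 : ℝ) 1 ×ˢ (frontier E ∩ Metric.ball p R))) ∧
    (∀ α : ℝ, 0 < α → α ≤ 1 → IsC1HolderBoundaryIn E α (Metric.ball p R) →
      ∀ a : ℝ, HasContributionAtInfinity E a →
      ContinuousOn (fun q : ℝ × RSpace n => rescaledCurvatureToZero E a q.1 q.2)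
        (Ico (0 : ℝ) α ×ˢ (frontier E ∩ Metric.ball p R))) := by
  refine ⟨fun α hα hα1 hreg => ⟨fun s hs x hx => ?_, hreg.continuousOn_fracCurvature hE hα hα1⟩,
    fun hreg => ⟨fun s hs x hx => ?_, hreg.continuousOn_rescaledCurvatureToOne hE⟩,
    fun α hα hα1 hreg a ha => hreg.continuousOn_rescaledCurvatureToZero hE hα hα1 ha⟩
  · exact (hreg.hasFracCurvature hE hα hα1 hx hs.1 hs.2).1
  · exact (hreg.isC1HolderBoundaryIn.hasFracCurvature hE one_pos le_rfl hx hs.1 hs.2).1
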